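/- **Definitions.** All chains have coefficients in $\mathbb Z/2$ and live in $\mathbb R^3$. Let $\mathbf P_k$ be the group of polyhedral $k$-chains mod two ($\mathbf P_{-1}=0$), generated by the $k$-simplices $\sigma$; let $M(P)$ be the mass of $P$, i.e. the $k$-dimensional volume of the set covered an odd number of times, and $\partial$ the boundary ($\partial=0$ on $\mathbf P_0$). A *$k$-dipolyhedron* is an element $D=\delta B+\mu C$ of the direct sum $\mathbf D_k=\delta\mathbf P_k\oplus\mu\mathbf P_{k-1}$ of the groups of dipole chains $\delta B$ ($B\in\mathbf P_k$) and mass chains $\mu C$ ($C\in\mathbf P_{k-1}$). The boundary on dipolyhedra satisfies $\delta=\partial\mu+\mu\partial$, so $\partial(\delta B+\mu C)=\delta(\partial B+C)+\mu(\partial C)$; on $\mathbf D_0$ it is zero. The support $|D|$ is the union of the cells of $D$, the energy is $E(D)=M(B)+M(C)$, and $$E_\flat(D)=\inf\{E(Q)+E(R): D=Q+\partial R,\ Q\in\mathbf D_k,\ R\in\mathbf D_{k+1}\}.$$ The completion $\mathcal D_k$ of $\mathbf D_k$ in $E_\flat$ is the group of *flat $k$-dipolyhedra*; $\partial$ and $E_\flat$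 extend to it by continuity. For $A\in\mathcal D_k$ let $E(A)\in[0,\infty]$ be the least value of $\liminf E(D_i)$ over sequences $D_i\in\mathbf D_k$ with $D_i\to A$ in $E_\flat$. A closed set $F$ *supports* $A$ if for every open $U\supseteq F$ there are $D_i\in\mathbf D_k$ with $D_i\to A$ and $|D_i|\subseteq U$ for all $i$; $A$ is *compactly supported* if some compact set supports it. Let $Q(p,r)$ be the closed cube with centre $p$ and side length $r>0$, with sides parallel to the axes. For a point $p$ and a simplex $\sigma$ let $p\sigma$ be the cone over $\sigma$ with vertex $p$; extend linearly to chains and put $p(\delta B+\mu C)=\delta(pB)+\mu(pC)$. **Statement.** Let $p\in\mathbb R^3$ and $k\ge 0$. 1. If $D\in\mathbf D_k$ and $|D|\subseteq Q(p,r)$, then $E_\flat(pD)\le\left(1+\frac{r\sqrt3}{k+1}\right)E_\flat(D)$. 2. If $A\in\mathcal D_k$ is compactly supported, then the cone $pA\in\mathcal D_{k+1}$ is well defined: there are sequences $D_i\in\mathbf D_k$ with $D_i\to A$ whose supports lie in one bounded set, and there is exactly one element $pA$ such that $pD_i\to pA$ for every such sequence. 3. If $A\in\mathcal D_k$ is compactly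 supported, then so is $\partial A$ (for $k\ge1$), and $$A=\partial(pA)+p(\partial A)$$ holds if $k\ge2$. For $k=1$ (and for $k=0$, where $\partial A=0$ and the formula reads $A=\partial(pA)$) it holds if $A$ is a limit of dipolyhedra $\delta B_i+\mu C_i$ in which the $0$-chain $C_i$ (for $k=0$: the $0$-chain $B_i$) consists of an even number of points. 4. If $A\in\mathcal D_k$ is supported by $Q(p,r)$, then $$E_\flat(pA)\le\left(1+\frac{r\sqrt3}{k+1}\right)E_\flat(A)\quad\text{and}\quad E(pA)\le\frac{r\sqrt3}{k+1}\,E(A).$$ -/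

import Mathlib

open Filter Topology MeasureTheory
open scoped ENNReal

/-- Euclidean three-space. -/
abbrev E3 : Type := EuclideanSpace ℝ (Fin 3)

namespace Dipolyhedron

noncomputable section

/-! ## Polyhedral chains with coefficients in `ℤ/2`

A cell is a simplex given by its vertices, and it is indexed by the *number* `j` of its vertices, so
that `Cell j` is the type of `(j - 1)`-cells.  There are no cells of dimension `-1`.  Degenerate
simplices are allowed; they have mass zero. -/

/-- The `(j - 1)`-cells (simplices with `j ≥ 1` vertices) of `ℝ³`. -/
abbrev Cell (j : ℕ) : Type := {_v : Fin j → E3 // 0 < j}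

/-- The point set `|σ|` of a cell. -/
def Cell.carrier {j : ℕ} (σ : Cell j) : Set E3 := convexHull ℝ (Set.range σ.1)

/-- The `i`-th facet of a cell of positive dimension. -/
def Cell.face {j : ℕ} (h : 0 < j) (σ : Cell (j + 1)) (i : Fin (j + 1)) : Cell j :=
  ⟨fun m => σ.1 (i.succAbove m), h⟩

/-- The cone `pσ` of a cell over the point `p`: the simplex with the additional vertex `p`. -/
def Cell.cone (p : E3) {j : ℕ} (σ : Cell j) : Cell (j + 1) := ⟨Fin.cons p σ.1, j.succ_pos⟩

/-- Polyhedral `(j - 1)`-chains mod two in `ℝ³`, given as finite formal sums of cells.  Formal sums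
that represent the same polyhedral chain (for instance a cell and the sum of the pieces of a
subdivision) differ by a chain of mass zero; they are identified when the separated completion is
formed below. -/
abbrev Chain (j : ℕ) : Type := Cell j →₀ ZMod 2

/-- The boundary `∂σ` of a cell: the sum of its facets; it is zero if `σ` is a point. -/
def Cell.boundary {j : ℕ} (σ : Cell (j + 1)) : Chain j :=
  if h : 0 < j then ∑ i : Fin (j + 1), Finsupp.single (σ.face h i) 1 else 0

/-- The boundary operator on chains. -/
def Chain.boundary (j : ℕ) : Chain (j + 1) →ₗ[ZMod 2] Chain j :=
  Finsupp.linearCombination (ZMod 2) Cell.boundary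

/-- The cone operator on chains, the linear extension of `σ ↦ pσ`. -/
def Chain.cone (p : E3) (j : ℕ) : Chain j →ₗ[ZMod 2] Chain (j + 1) :=
  Finsupp.linearCombination (ZMod 2) (fun σ => Finsupp.single (σ.cone p) 1)

/-- The point set of a chain: the union of its cells. -/
def Chain.carrier {j : ℕ} (c : Chain j) : Set E3 := ⋃ σ ∈ c.support, σ.carrier

/-- The multiplicity mod two of a chain at a point. -/
def Chain.multiplicity {j : ℕ} (c : Chain j) (x : E3) : ZMod 2 :=
  c.sum fun σ a => σ.carrier.indicator (fun _ => a) x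

/-- The mass of a `(j - 1)`-chain: the `(j - 1)`-dimensional volume of the set that the chain covers
an odd number of times.  For a sum of nonoverlapping nondegenerate cells it is the sum of
the `(j - 1)`-volumes of the cells. -/
def Chain.mass {j : ℕ} (c : Chain j) : ℝ :=
  (Measure.euclideanHausdorffMeasure (j - 1) {x : E3 | c.multiplicity x ≠ 0}).toReal

/-- The number mod two of the points of a `0`-chain (and zero for chains of other dimensions). -/
def Chain.parity {j : ℕ} (c : Chain j) : ZMod 2 := if j = 1 then c.sum fun _ a => a else 0

/-! ## Dipolyhedra -/

/-- The `k`-dipolyhedra `S + T` with coefficients in `ℤ/2`, the direct sum of the dipole `k`-chains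
`S = δB`, where `B` is a `k`-chain, and of the mass `k`-chains `T = μC`, where `C` is a
`(k - 1)`-chain. -/
def Dip (k : ℕ) : Type := Chain (k + 1) × Chain k

instance instAddCommGroupDip (k : ℕ) : AddCommGroup (Dip k) :=
  inferInstanceAs (AddCommGroup (Chain (k + 1) × Chain k))

/-- The dipole chain `δB`. -/
def dipole (k : ℕ) : Chain (k + 1) →+ Dip k := AddMonoidHom.inl _ _

/-- The mass chain `μC`. -/
def massChain (k : ℕ) : Chain k →+ Dip k := AddMonoidHom.inr _ _

/-- The projection of the dipole part of a dipolyhedron into `ℝ³`, `δB + μC ↦ B`. -/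
def Dip.dipolePart (k : ℕ) : Dip k →+ Chain (k + 1) := AddMonoidHom.fst _ _

/-- The projection of the mass part of a dipolyhedron into `ℝ³`, `δB + μC ↦ C`. -/
def Dip.massPart (k : ℕ) : Dip k →+ Chain k := AddMonoidHom.snd _ _

/-- The boundary operator of dipolyhedra.  By definition of the dipole cells, `δ = ∂μ + μ∂`; hence
`∂δ = δ∂`, and mod two `∂μ = δ + μ∂`. -/
def Dip.boundary (k : ℕ) : Dip (k + 1) →+ Dip k :=
  (dipole k).comp ((Chain.boundary (k + 1)).toAddMonoidHom.comp (Dip.dipolePart (k + 1))) +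
    ((dipole k).comp (Dip.massPart (k + 1)) +
      (massChain k).comp ((Chain.boundary k).toAddMonoidHom.comp (Dip.massPart (k + 1))))

/-- The cone operator of dipolyhedra, `pδ = δp` and `pμ = μp`. -/
def Dip.cone (p : E3) (k : ℕ) : Dip k →+ Dip (k + 1) :=
  (dipole (k + 1)).comp ((Chain.cone p (k + 1)).toAddMonoidHom.comp (Dip.dipolePart k)) +
    (massChain (k + 1)).comp ((Chain.cone p k).toAddMonoidHom.comp (Dip.massPart k))

/-- The weight `W(S)` of the dipole part. -/
def Dip.weight {k : ℕ} (D : Dip k) : ℝ := (Dip.dipolePart k D).mass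

/-- The mass `M(T)` of the mass part. -/
def Dip.mass {k : ℕ} (D : Dip k) : ℝ := (Dip.massPart k D).mass

/-- The energy `E(D) = W(S) + M(T)`. -/
def Dip.energy {k : ℕ} (D : Dip k) : ℝ := D.weight + D.mass

/-- The support `|D|`, the union of the cells of `D`. -/
def Dip.carrier {k : ℕ} (D : Dip k) : Set E3 :=
  (Dip.dipolePart k D).carrier ∪ (Dip.massPart k D).carrier

/-- The number mod two of the points that underlie the dipole `0`-cells (if `k = 0`) or the mass
`1`-cells (if `k = 1`) of a `k`-dipolyhedron; zero if `k ≥ 2`. -/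
def Dip.parity {k : ℕ} (D : Dip k) : ZMod 2 :=
  (Dip.dipolePart k D).parity + (Dip.massPart k D).parity

/-- The norm `E_♭(D) = inf {E(Q) + E(R) : D = Q + ∂R}`. -/
def Dip.flatNorm {k : ℕ} (D : Dip k) : ℝ :=
  sInf {e : ℝ | ∃ (Q : Dip k) (R : Dip (k + 1)),
    D = Q + Dip.boundary k R ∧ e = Q.energy + R.energy}

/-! ### The flat norm is a seminorm on formal dipolyhedra and `∂` is a contraction -/

lemma Cell.measure_carrier_lt_top {j : ℕ} (σ : Cell j) :
    (Measure.euclideanHausdorffMeasure (j - 1) : Measure E3) σ.carrier < ⊤ := by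
  obtain ⟨v, hj⟩ := σ
  obtain ⟨d, rfl⟩ : ∃ d, j = d + 1 := ⟨j - 1, by omega⟩
  let L : (Fin d → ℝ) →ₗ[ℝ] E3 := Fintype.linearCombination ℝ (fun i : Fin d => v i.succ - v 0)
  let f : (Fin d → ℝ) → E3 := fun t => L t + v 0
  have hf : LipschitzWith ‖L.toContinuousLinearMap‖₊ f := by
    have h := L.toContinuousLinearMap.lipschitz
    intro x y
    have h2 := h x y
    simpa [f] using h2
  have hsub : convexHull ℝ (Set.range v) ⊆ f '' Set.Icc 0 1 := by
    refine convexHull_min ?_ ?_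
    · rintro _ ⟨i, rfl⟩
      refine Fin.cases ?_ (fun i => ?_) i
      · exact ⟨0, ⟨le_refl _, zero_le_one⟩, by simp [f]⟩
      · refine ⟨Pi.single i 1, ⟨?_, ?_⟩, ?_⟩
        · intro m
          by_cases h : m = i
          · subst h; simp
          · simp [h]
        · intro m
          by_cases h : m = i
          · subst h; simp
          · simp [h]
        · simp [f, L]
    · have h1 : Convex ℝ (L '' Set.Icc 0 1) := (convex_Icc (0 : Fin d → ℝ) 1).linear_image L
      have h2 : f '' Set.Icc 0 1 = (fun z => z + v 0) '' (L '' Set.Icc 0 1) := by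
        rw [Set.image_image]
      rw [h2]
      have := h1.translate (v 0)
      simpa [add_comm] using this
  have h0 : (Measure.hausdorffMeasure ((d : ℕ) : ℝ) : Measure E3) (f '' Set.Icc 0 1) < ⊤ := by
    refine lt_of_le_of_lt (hf.hausdorffMeasure_image_le (Nat.cast_nonneg d) _) ?_
    have h3 : (Measure.hausdorffMeasure ((d : ℕ) : ℝ) : Measure (Fin d → ℝ)) = volume := by
      have := hausdorffMeasure_pi_real (ι := Fin d)
      simpa using this
    rw [h3]
    refine ENNReal.mul_lt_top (by simp) ?_
    exact isCompact_Icc.measure_lt_top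
  have h1 := lt_of_le_of_lt (measure_mono hsub) h0
  rw [show d + 1 - 1 = d by omega, Measure.euclideanHausdorffMeasure_def]
  rw [Measure.smul_apply, ENNReal.smul_def, smul_eq_mul]
  exact ENNReal.mul_lt_top (by simp) h1

lemma Chain.oddSet_subset_carrier {j : ℕ} (c : Chain j) :
    {x : E3 | c.multiplicity x ≠ 0} ⊆ c.carrier := by
  intro x hx
  by_contra hn
  refine hx (Finset.sum_eq_zero fun σ hσ => ?_)
  refine Set.indicator_of_notMem (fun h => hn ?_) _
  exact Set.mem_biUnion hσ h

lemma Chain.measure_oddSet_ne_top {j : ℕ} (c : Chain j) :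
    (Measure.euclideanHausdorffMeasure (j - 1) : Measure E3) {x : E3 | c.multiplicity x ≠ 0}
      ≠ ⊤ := by
  refine ne_of_lt (lt_of_le_of_lt (measure_mono c.oddSet_subset_carrier) ?_)
  refine lt_of_le_of_lt (measure_biUnion_finset_le _ _) ?_
  exact ENNReal.sum_lt_top.2 fun σ _ => σ.measure_carrier_lt_top

lemma Chain.multiplicity_add {j : ℕ} (c d : Chain j) (x : E3) :
    (c + d).multiplicity x = c.multiplicity x + d.multiplicity x := by
  classical
  refine Finsupp.sum_add_index' (fun σ => ?_) (fun σ a b => ?_)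
  · simp
  · by_cases h : x ∈ σ.carrier <;> simp [h]

lemma Chain.mass_zero {j : ℕ} : (0 : Chain j).mass = 0 := by
  simp [Chain.mass, Chain.multiplicity]

lemma Chain.mass_nonneg {j : ℕ} (c : Chain j) : 0 ≤ c.mass := ENNReal.toReal_nonneg

lemma Chain.mass_add_le {j : ℕ} (c d : Chain j) : (c + d).mass ≤ c.mass + d.mass := by
  unfold Chain.mass
  rw [← ENNReal.toReal_add c.measure_oddSet_ne_top d.measure_oddSet_ne_top]
  refine ENNReal.toReal_mono
    (ENNReal.add_ne_top.2 ⟨c.measure_oddSet_ne_top, d.measure_oddSet_ne_top⟩) ?_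
  refine le_trans (measure_mono ?_) (measure_union_le _ _)
  intro x hx
  by_contra hn
  simp only [Set.mem_union, Set.mem_ofPred_eq, not_or, not_not] at hn
  exact hx (by rw [Chain.multiplicity_add, hn.1, hn.2, add_zero])

lemma Chain.neg_eq {j : ℕ} (c : Chain j) : -c = c := by
  ext σ
  simp [ZMod.neg_eq_self_mod_two]

lemma Cell.boundary_boundary {j : ℕ} (σ : Cell (j + 2)) :
    Chain.boundary j (Cell.boundary σ) = 0 := by
  rw [Cell.boundary, dif_pos (Nat.succ_pos j), map_sum]
  simp only [Chain.boundary, Finsupp.linearCombination_single, one_smul]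
  by_cases h : 0 < j
  · simp only [Cell.boundary, dif_pos h]
    rw [← Finset.sum_product']
    refine Finset.sum_involution (fun q _ => (q.1.succAbove q.2, q.2.predAbove q.1)) ?_ ?_ ?_ ?_
    · rintro ⟨a, b⟩ _
      have : ((σ.face (Nat.succ_pos j) (a.succAbove b)).face h (b.predAbove a)) =
          ((σ.face (Nat.succ_pos j) a).face h b) := by
        apply Subtype.ext
        funext m
        simp only [Cell.face]
        rw [Fin.succAbove_succAbove_succAbove_predAbove]
      simp only [this]
      rw [← Finsupp.single_add]
      have h2 : (1 : ZMod 2) + 1 = 0 := by decide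
      rw [h2, Finsupp.single_zero]
    · rintro ⟨a, b⟩ _ _ he
      exact Fin.succAbove_ne a b (congrArg Prod.fst he)
    · intro q _
      exact Finset.mem_product.2 ⟨Finset.mem_univ _, Finset.mem_univ _⟩
    · rintro ⟨a, b⟩ _
      simp only [Fin.succAbove_succAbove_predAbove, Fin.predAbove_predAbove_succAbove]
  · simp only [Cell.boundary, dif_neg h, Finset.sum_const_zero]

lemma Chain.boundary_boundary {j : ℕ} (c : Chain (j + 2)) :
    Chain.boundary j (Chain.boundary (j + 1) c) = 0 := by
  induction c using Finsupp.induction_linear with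
  | zero => simp
  | add f g hf hg => rw [map_add, map_add, hf, hg, add_zero]
  | single σ a =>
    have h : Chain.boundary (j + 1) (Finsupp.single σ a) = a • Cell.boundary σ :=
      Finsupp.linearCombination_single _ _ _
    rw [h, map_smul, Cell.boundary_boundary, smul_zero]

lemma Dip.boundary_apply (k : ℕ) (D : Dip (k + 1)) :
    Dip.boundary k D =
      dipole k (Chain.boundary (k + 1) (Dip.dipolePart (k + 1) D) + Dip.massPart (k + 1) D) +
        massChain k (Chain.boundary k (Dip.massPart (k + 1) D)) := by
  rw [map_add, add_assoc]
  rfl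

lemma Dip.boundary_boundary {k : ℕ} (D : Dip (k + 2)) :
    Dip.boundary k (Dip.boundary (k + 1) D) = 0 := by
  have h : ∀ c : Chain (k + 1), c + c = 0 := fun c => by
    nth_rewrite 1 [← Chain.neg_eq c]
    exact neg_add_cancel c
  have e1 : Dip.dipolePart (k + 1) (Dip.boundary (k + 1) D) =
      Chain.boundary (k + 2) (Dip.dipolePart (k + 2) D) + Dip.massPart (k + 2) D := by
    rw [Dip.boundary_apply]
    exact add_zero _
  have e2 : Dip.massPart (k + 1) (Dip.boundary (k + 1) D) =
      Chain.boundary (k + 1) (Dip.massPart (k + 2) D) := by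
    rw [Dip.boundary_apply]
    exact zero_add _
  have e3 := Chain.boundary_boundary (Dip.dipolePart (k + 2) D)
  have e4 := Chain.boundary_boundary (Dip.massPart (k + 2) D)
  rw [Dip.boundary_apply, e1, e2, map_add (Chain.boundary (k + 1)), e3, e4, zero_add, h, map_zero, map_zero, add_zero]

lemma Dip.energy_zero {k : ℕ} : (0 : Dip k).energy = 0 := by
  simp [Dip.energy, Dip.weight, Dip.mass, Chain.mass_zero]

lemma Dip.energy_nonneg {k : ℕ} (D : Dip k) : 0 ≤ D.energy :=
  add_nonneg (Chain.mass_nonneg _) (Chain.mass_nonneg _)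

lemma Dip.energy_add_le {k : ℕ} (D D' : Dip k) : (D + D').energy ≤ D.energy + D'.energy := by
  have h1 := Chain.mass_add_le (Dip.dipolePart k D) (Dip.dipolePart k D')
  have h2 := Chain.mass_add_le (Dip.massPart k D) (Dip.massPart k D')
  simp only [Dip.energy, Dip.weight, Dip.mass, map_add]
  linarith

lemma Dip.neg_eq {k : ℕ} (D : Dip k) : -D = D :=
  Prod.ext (Chain.neg_eq _) (Chain.neg_eq _)

lemma Dip.flatNorm_le {k : ℕ} {D Q : Dip k} {R : Dip (k + 1)}
    (h : D = Q + Dip.boundary k R) : D.flatNorm ≤ Q.energy + R.energy := by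
  refine csInf_le ⟨0, ?_⟩ ⟨Q, R, h, rfl⟩
  rintro e ⟨Q, R, _, rfl⟩
  exact add_nonneg Q.energy_nonneg R.energy_nonneg

lemma Dip.exists_decomposition {k : ℕ} (D : Dip k) {ε : ℝ} (hε : 0 < ε) :
    ∃ (Q : Dip k) (R : Dip (k + 1)), D = Q + Dip.boundary k R ∧
      Q.energy + R.energy < D.flatNorm + ε := by
  have hne : {e : ℝ | ∃ (Q : Dip k) (R : Dip (k + 1)),
      D = Q + Dip.boundary k R ∧ e = Q.energy + R.energy}.Nonempty :=
    ⟨_, D, 0, by simp, rfl⟩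
  obtain ⟨_, ⟨Q, R, h, rfl⟩, hlt⟩ := exists_lt_of_csInf_lt hne (lt_add_of_pos_right _ hε)
  exact ⟨Q, R, h, hlt⟩

lemma Dip.flatNorm_zero {k : ℕ} : (0 : Dip k).flatNorm = 0 := by
  refine le_antisymm ?_ (Real.sInf_nonneg ?_)
  · have := Dip.flatNorm_le (D := (0 : Dip k)) (Q := 0) (R := 0) (by simp)
    simpa [Dip.energy_zero] using this
  · rintro e ⟨Q, R, _, rfl⟩
    exact add_nonneg Q.energy_nonneg R.energy_nonneg

lemma Dip.flatNorm_add_le {k : ℕ} (D D' : Dip k) :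
    (D + D').flatNorm ≤ D.flatNorm + D'.flatNorm := by
  refine le_of_forall_pos_le_add fun ε hε => ?_
  obtain ⟨Q, R, h, hl⟩ := D.exists_decomposition (half_pos hε)
  obtain ⟨Q', R', h', hl'⟩ := D'.exists_decomposition (half_pos hε)
  have h1 : (D + D').flatNorm ≤ (Q + Q').energy + (R + R').energy := by
    refine Dip.flatNorm_le ?_
    rw [map_add, h, h']
    abel
  have h2 := Q.energy_add_le Q'
  have h3 := R.energy_add_le R'
  linarith

/-- The flat norm as a group seminorm on formal dipolyhedra. -/
def Dip.flatSeminorm (k : ℕ) : AddGroupSeminorm (Dip k) where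
  toFun := Dip.flatNorm
  map_zero' := Dip.flatNorm_zero
  add_le' := Dip.flatNorm_add_le
  neg' D := by rw [Dip.neg_eq]

instance instSeminormedDip (k : ℕ) : SeminormedAddCommGroup (Dip k) :=
  (Dip.flatSeminorm k).toSeminormedAddCommGroup

lemma Dip.norm_eq {k : ℕ} (D : Dip k) : ‖D‖ = D.flatNorm := rfl

lemma Dip.flatNorm_boundary_le {k : ℕ} (D : Dip (k + 1)) :
    (Dip.boundary k D).flatNorm ≤ D.flatNorm := by
  refine le_of_forall_pos_le_add fun ε hε => ?_
  obtain ⟨Q, R, h, hl⟩ := D.exists_decomposition hε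
  have h1 : (Dip.boundary k D).flatNorm ≤ (0 : Dip k).energy + Q.energy := by
    refine Dip.flatNorm_le ?_
    rw [h, map_add, Dip.boundary_boundary, add_zero, zero_add]
  have h2 := R.energy_nonneg
  rw [Dip.energy_zero] at h1
  linarith

lemma Dip.continuous_boundary (k : ℕ) : Continuous (Dip.boundary k) :=
  AddMonoidHomClass.continuous_of_bound (Dip.boundary k) 1 fun D => by
    rw [one_mul]
    exact D.flatNorm_boundary_le

/-! ## Flat dipolyhedra -/

/-- The flat `k`-dipolyhedra with coefficients in `ℤ/2`: the (separated) completion of the group of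
`k`-dipolyhedra in the norm `E_♭`.  The norm `E_♭` of a flat dipolyhedron `A` is `‖A‖`. -/
abbrev FlatDip (k : ℕ) : Type := UniformSpace.Completion (Dip k)

/-- The boundary operator of flat dipolyhedra, the continuous extension of `∂`. -/
def FlatDip.boundary (k : ℕ) : FlatDip (k + 1) →+ FlatDip k :=
  (Dip.boundary k).completion (Dip.continuous_boundary k)

/-- `D₀, D₁, …` are dipolyhedra that tend to `A` in the norm `E_♭`. -/
def TendsToFlat {k : ℕ} (D : ℕ → Dip k) (A : FlatDip k) : Prop :=
  Tendsto (fun i => (D i : FlatDip k)) atTop (𝓝 A)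

/-- The energy of a flat dipolyhedron: the least value of `liminf E(Dᵢ)` over all sequences of
dipolyhedra `Dᵢ` that tend to `A` in the norm `E_♭`. -/
def FlatDip.energy {k : ℕ} (A : FlatDip k) : ℝ≥0∞ :=
  ⨅ (D : ℕ → Dip k) (_ : TendsToFlat D A), liminf (fun i => ENNReal.ofReal (D i).energy) atTop

/-- The closed set `F` supports `A`: for every open set `U ⊇ F` there are dipolyhedra that tend
to `A` and have their supports in `U`. -/
def Supports {k : ℕ} (F : Set E3) (A : FlatDip k) : Prop :=
  IsClosed F ∧ ∀ U : Set E3, IsOpen U → F ⊆ U →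
    ∃ D : ℕ → Dip k, TendsToFlat D A ∧ ∀ i, (D i).carrier ⊆ U

/-- `A` is supported by some compact set. -/
def CompactlySupported {k : ℕ} (A : FlatDip k) : Prop := ∃ K : Set E3, IsCompact K ∧ Supports K A

/-- The (closed) cube `Q(p, r)` with centre `p` and side length `r`. -/
def cube (p : E3) (r : ℝ) : Set E3 := {x | ∀ i, |x i - p i| ≤ r / 2}

/-- `D₀, D₁, …` tend to `A` and all their supports lie in one bounded set. -/
def BoundedlyTendsTo {k : ℕ} (D : ℕ → Dip k) (A : FlatDip k) : Prop :=
  TendsToFlat D A ∧ Bornology.IsBounded (⋃ i, (D i).carrier)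

/-- `X` is the cone over `A`: the limit of `pDᵢ` for every sequence of dipolyhedra `Dᵢ` with
uniformly bounded supports that tends to `A` (and such sequences exist). -/
def IsCone {k : ℕ} (p : E3) (A : FlatDip k) (X : FlatDip (k + 1)) : Prop :=
  (∃ D : ℕ → Dip k, BoundedlyTendsTo D A) ∧
    ∀ D : ℕ → Dip k, BoundedlyTendsTo D A → TendsToFlat (fun i => Dip.cone p k (D i)) X

open Classical in
/-- The cone `pA` over a flat dipolyhedron `A` (zero if there is none). -/
def FlatDip.cone {k : ℕ} (p : E3) (A : FlatDip k) : FlatDip (k + 1) :=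
  if h : ∃ X, IsCone p A X then h.choose else 0

/-- `A` is a limit of dipolyhedra whose `0`-dimensional part has an even number of points (no
condition if `k ≥ 2`). -/
def EvenZeroPart {k : ℕ} (A : FlatDip k) : Prop :=
  ∃ D : ℕ → Dip k, TendsToFlat D A ∧ ∀ i, (D i).parity = 0

end

end Dipolyhedron

namespace Dipolyhedron

noncomputable section

/-! ## Hausdorff measure of flat sets and of cones -/

/-! Three facts about chains carry the proof. (a) The cone from `p` over a `d`-chain lying within
distance `R` of `p` has at most `R / (d + 1)` times its mass (`Chain.mass_cone_le`). (b) Mod two,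
`∂(pC) = C + p(∂C)`, except that over a `0`-chain with an odd number of points an extra `p` appears
(`Chain.boundary_cone`). (c) There is a chain map of all chains onto the chains in a cube which
fixes the latter and does not increase mass (`exists_retraction_cube`).

In the cube `Q(p, r)` one has `R = r√3/2`, the half diagonal. For a `k`-dipolyhedron, (a) gives the
factor `r√3/(2(k+1))` on the dipole part and `r√3/(2k)` on the mass part; as `2k ≥ k + 1` for `k ≥
1`, both are at most `c = r√3/(k+1)`, and `E(pD) ≤ c E(D)`.

If `D = Q + ∂R` is nearly optimal, then (b) gives `pD = (pQ + R) + ∂(pR)`, whose cost is at most `(1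
+ c)(E(Q) + E(R))`. This needs `Q` and `R` in the cube, which (c) provides, and no extra `p`, which
matters only for `k = 0` and is arranged by moving the mass part of `R` into `Q`.

So the cone operator is Lipschitz on the dipolyhedra in a fixed cube and extends to limits with
bounded supports. The homotopy formula passes to the limit because parity is locally constant in the
flat norm: a `0`-chain of mass less than one is zero and boundaries are even. For the energy
estimate, (c) pushes an arbitrary approximating sequence into a slightly larger cube without raising
its energy or changing its limit.

The retraction (c) is a composition of six nearest point projections onto half-spaces. Each is
affine on either side of its plane, so chains are first subdivided along the plane by coning; the
comparison of a simplex with its stellar subdivision shows that this changes a chain only by mass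
zero. -/

lemma hausdorff_eq_zero_of_finrank_lt {d : ℕ} {S : Set E3} (p : E3) (W : Submodule ℝ E3)
    (hW : Module.finrank ℝ W < d) (hS : ∀ x ∈ S, x - p ∈ W) :
    (Measure.euclideanHausdorffMeasure d : Measure E3) S = 0 := by
  have hf : Isometry (fun w : W => p + (w : E3)) :=
    Isometry.of_dist_eq fun a b => by simp [Subtype.dist_eq]
  have h0 : (Measure.euclideanHausdorffMeasure d : Measure W) Set.univ = 0 := by
    have h : (Measure.hausdorffMeasure (d : ℝ) : Measure W) = 0 :=
      Real.hausdorffMeasure_of_finrank_lt (by exact_mod_cast hW)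
    rw [Measure.euclideanHausdorffMeasure_def, h]
    simp
  refine measure_mono_null ?_ ((hf.euclideanHausdorffMeasure_image (d := d) Set.univ).trans h0)
  intro x hx
  exact ⟨⟨x - p, hS x hx⟩, trivial, by simp⟩

lemma hausdorff_eq_zero_of_span {d : ℕ} {ι : Type*} [Fintype ι] {S : Set E3} (p : E3) (w : ι → E3)
    (hn : Fintype.card ι < d ∨ (Fintype.card ι ≤ d ∧ ¬ LinearIndependent ℝ w))
    (hS : ∀ x ∈ S, x - p ∈ Submodule.span ℝ (Set.range w)) :
    (Measure.euclideanHausdorffMeasure d : Measure E3) S = 0 := by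
  refine hausdorff_eq_zero_of_finrank_lt p _ ?_ hS
  have h1 : Module.finrank ℝ (Submodule.span ℝ (Set.range w)) ≤ Fintype.card ι := by
    simpa [Set.finrank] using finrank_range_le_card (R := ℝ) w
  rcases hn with hn | ⟨hn, hw⟩
  · exact h1.trans_lt hn
  · refine lt_of_lt_of_le (lt_of_le_of_ne h1 fun h => hw ?_) hn
    rw [linearIndependent_iff_card_eq_finrank_span]
    simpa [Set.finrank] using h.symm

/-- The cone over a set, without its vertex. -/
def openCone {V : Type*} [AddCommGroup V] [Module ℝ V] (p : V) (S : Set V) : Set V :=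
  {x | ∃ t : ℝ, 0 < t ∧ t ≤ 1 ∧ ∃ y ∈ S, x = p + t • (y - p)}

open Pointwise in
-- Fubini along `v`: `S` lies in the hyperplane through `v` orthogonal to `v`, so the slice of the
-- cone at height `x • v` is contained in `x • S`, of measure `x ^ d` times that of `S`, and is
-- empty unless `0 < x ≤ 1`. The parametrization by `x • v` contributes `‖v‖` and the integral of `x
-- ^ d` contributes `1 / (d + 1)`.
lemma hausdorff_openCone_le_of_hyperplane {V : Type*} [NormedAddCommGroup V]
    [InnerProductSpace ℝ V] [FiniteDimensional ℝ V] [MeasurableSpace V] [BorelSpace V] {d : ℕ}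
    (hd : Module.finrank ℝ V = d + 1) {v : V} (hv : v ≠ 0) {S : Set V} (hS : MeasurableSet S)
    (hSv : ∀ y ∈ S, inner ℝ v y = ‖v‖ ^ 2) :
    (Measure.euclideanHausdorffMeasure (d + 1) : Measure V) (openCone 0 S) ≤
      ENNReal.ofReal (‖v‖ / (d + 1)) * (Measure.euclideanHausdorffMeasure d : Measure V) S := by
  have hv2 : 0 < ‖v‖ ^ 2 := by positivity
  have hT : openCone 0 S = {x | 0 < inner ℝ v x / ‖v‖ ^ 2 ∧ inner ℝ v x / ‖v‖ ^ 2 ≤ 1} ∩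
      (fun x : V => (inner ℝ v x / ‖v‖ ^ 2)⁻¹ • x) ⁻¹' S := by
    ext x
    constructor
    · rintro ⟨t, h0, h1, y, hy, rfl⟩
      have : inner ℝ v (0 + t • (y - 0)) / ‖v‖ ^ 2 = t := by
        rw [zero_add, sub_zero, inner_smul_right, hSv y hy, mul_div_assoc, div_self hv2.ne', mul_one]
      refine ⟨?_, ?_⟩
      · simp only [Set.mem_ofPred_eq]
        rw [this]; exact ⟨h0, h1⟩
      · simp only [Set.mem_preimage]
        rw [this, zero_add, sub_zero, smul_smul, inv_mul_cancel₀ h0.ne', one_smul]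
        exact hy
    · rintro ⟨⟨h0, h1⟩, h2⟩
      refine ⟨_, h0, h1, _, h2, ?_⟩
      rw [zero_add, sub_zero, smul_smul, mul_inv_cancel₀ h0.ne', one_smul]
  have hm : Measurable fun x : V => inner ℝ v x / ‖v‖ ^ 2 := by fun_prop
  have hTm : MeasurableSet (openCone 0 S) := by
    rw [hT]
    refine MeasurableSet.inter ?_ ?_
    · exact (measurableSet_lt measurable_const hm).inter (measurableSet_le hm measurable_const)
    · exact (hm.inv.smul measurable_id) hS
  have key := EuclideanGeometry.euclideanHausdorffMeasure_eq_lintegral (P := V) (0 : V) hv hTm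
  rw [hd] at key
  rw [key]
  simp only [add_tsub_cancel_right]
  set m := (Measure.euclideanHausdorffMeasure d : Measure V) S with hmdef
  have hbound : ∀ x : ℝ, (Measure.euclideanHausdorffMeasure d : Measure V)
      (openCone 0 S ∩ (AffineSubspace.mk' (x • v +ᵥ (0 : V)) (ℝ ∙ v)ᗮ : AffineSubspace ℝ V)) ≤
      (Set.Ioc (0 : ℝ) 1).indicator (fun x => ENNReal.ofReal (x ^ d) * m) x := by
    intro x
    have hsub : openCone 0 S ∩ (AffineSubspace.mk' (x • v +ᵥ (0 : V)) (ℝ ∙ v)ᗮ : AffineSubspace ℝ V) ⊆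
        {z | x ∈ Set.Ioc (0 : ℝ) 1 ∧ z ∈ x • S} := by
      rintro _ ⟨⟨t, h0, h1, y, hy, rfl⟩, h2⟩
      have h3 : inner ℝ v ((0 + t • (y - 0)) - x • v) = 0 := by
        have h2' := h2
        rw [SetLike.mem_coe, AffineSubspace.mem_mk', Submodule.mem_orthogonal_singleton_iff_inner_right] at h2'
        simpa using h2'
      rw [inner_sub_right, zero_add, sub_zero, inner_smul_right, inner_smul_right, hSv y hy,
        real_inner_self_eq_norm_sq, ← sub_mul] at h3
      have h4 : t = x := by
        rcases mul_eq_zero.1 h3 with h | h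
        · linarith
        · exact absurd h hv2.ne'
      subst h4
      exact ⟨⟨h0, h1⟩, by rw [zero_add, sub_zero]; exact Set.smul_mem_smul_set hy⟩
    by_cases hx : x ∈ Set.Ioc (0 : ℝ) 1
    · rw [Set.indicator_of_mem hx]
      refine (measure_mono (hsub.trans fun z hz => hz.2)).trans ?_
      rw [Measure.euclideanHausdorffMeasure_smul₀ d hx.1.ne', ENNReal.smul_def, smul_eq_mul]
      refine le_of_eq ?_
      congr 1
      rw [ENNReal.coe_pow, ENNReal.ofReal_pow hx.1.le]
      congr 1
      rw [← Real.enorm_eq_ofReal hx.1.le]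
      rfl
    · rw [Set.indicator_of_notMem hx]
      refine le_of_eq (measure_mono_null hsub ?_)
      simp [hx]
  refine (mul_le_mul_right (lintegral_mono hbound) _).trans ?_
  rw [lintegral_indicator measurableSet_Ioc, lintegral_mul_const _ (by fun_prop)]
  have hint : ∫⁻ x in Set.Ioc (0 : ℝ) 1, ENNReal.ofReal (x ^ d) = ENNReal.ofReal (1 / (d + 1)) := by
    rw [← ofReal_integral_eq_lintegral_ofReal]
    · rw [← intervalIntegral.integral_of_le zero_le_one, integral_pow]
      simp
    · exact (intervalIntegral.intervalIntegrable_pow d).1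
    · exact (ae_restrict_iff' measurableSet_Ioc).2 (Eventually.of_forall fun x hx => pow_nonneg hx.1.le _)
  rw [hint, ← mul_assoc, ← ofReal_norm, ← ENNReal.ofReal_mul (norm_nonneg _), mul_one_div]

/-- Independence of the vectors `v i - p` puts the simplex into a hyperplane, not through `p`, of
the space `V` that they span. The distance of `p` from this hyperplane is the height of the cone,
and it is at most `R`. -/
lemma hausdorff_openCone_le {d : ℕ} (p : E3) {v : Fin (d + 1) → E3} {R : ℝ}
    (hv : LinearIndependent ℝ fun i => v i - p)
    (hR : ∀ x ∈ convexHull ℝ (Set.range v), dist x p ≤ R) {S : Set E3} (hS : MeasurableSet S)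
    (hSv : S ⊆ convexHull ℝ (Set.range v)) :
    (Measure.euclideanHausdorffMeasure (d + 1) : Measure E3) (openCone p S) ≤
      ENNReal.ofReal (R / (d + 1)) * (Measure.euclideanHausdorffMeasure d : Measure E3) S := by
  let V := Submodule.span ℝ (Set.range fun i => v i - p)
  let b : Module.Basis (Fin (d + 1)) ℝ V := Module.Basis.span hv
  have hfin : Module.finrank ℝ V = d + 1 := by
    rw [finrank_span_eq_card hv, Fintype.card_fin]
  let f : V →ₗ[ℝ] ℝ := b.constr ℝ fun _ => 1
  let w : V := (InnerProductSpace.toDual ℝ V).symm f.toContinuousLinearMap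
  have hw : ∀ y : V, inner ℝ w y = f y := fun y => by
    simp [w]
  have hb : ∀ i, ((b i : V) : E3) = v i - p := fun i =>
    congrArg Subtype.val (Module.Basis.span_apply hv i)
  have hfb : ∀ i, f (b i) = 1 := fun i => by simp [f]
  have hw0 : w ≠ 0 := by
    intro h
    have := hw (b 0)
    rw [h, hfb, inner_zero_left] at this
    exact zero_ne_one this
  have hwn : 0 < ‖w‖ := norm_pos_iff.2 hw0
  let ι : V → E3 := fun y => p + (y : E3)
  have hι : Isometry ι := Isometry.of_dist_eq fun a b => by simp [ι, Subtype.dist_eq]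
  have hhull : ∀ x ∈ convexHull ℝ (Set.range v), ∃ y : V, ι y = x ∧ f y = 1 := by
    intro x hx
    refine convexHull_min (s := Set.range v) (t := {x | ∃ y : V, ι y = x ∧ f y = 1}) ?_ ?_ hx
    · rintro _ ⟨i, rfl⟩
      exact ⟨b i, by simp [ι, hb], hfb i⟩
    · rintro _ ⟨y, rfl, hy⟩ _ ⟨z, rfl, hz⟩ s t hs ht hst
      refine ⟨s • y + t • z, ?_, ?_⟩
      · simp only [ι, Submodule.coe_add, Submodule.coe_smul]
        have : p = (s + t) • p := by rw [hst, one_smul]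
        nth_rewrite 1 [this]
        module
      · simp [hy, hz, hst]
  -- The foot of the perpendicular from the origin to the hyperplane `f = 1`; its length `‖w‖⁻¹` is
  -- the height of the cone.
  let u : V := (‖w‖ ^ 2)⁻¹ • w
  have hu : u ≠ 0 := smul_ne_zero (by positivity) hw0
  have hun : ‖u‖ = ‖w‖⁻¹ := by
    simp only [u, norm_smul, norm_inv, norm_pow, norm_norm]
    field_simp
  have huR : ‖u‖ ≤ R := by
    obtain ⟨y, hy, hfy⟩ := hhull (v 0) (subset_convexHull ℝ _ ⟨0, rfl⟩)
    have h1 := hR (v 0) (subset_convexHull ℝ _ ⟨0, rfl⟩)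
    have h2 : ‖y‖ = dist (v 0) p := by rw [← hy]; simp [ι, dist_eq_norm]
    have h3 := real_inner_le_norm w y
    rw [hw, hfy] at h3
    rw [hun, inv_le_iff_one_le_mul₀ hwn]
    calc 1 ≤ ‖w‖ * ‖y‖ := h3
      _ ≤ ‖w‖ * R := by gcongr; rw [h2]; exact h1
      _ = R * ‖w‖ := mul_comm _ _
  have hSr : S ⊆ Set.range ι := fun x hx => by
    obtain ⟨y, hy, _⟩ := hhull x (hSv hx)
    exact ⟨y, hy⟩
  have hS' : ι '' (ι ⁻¹' S) = S := Set.image_preimage_eq_of_subset hSr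
  have hcone : openCone p S = ι '' openCone 0 (ι ⁻¹' S) := by
    ext x
    constructor
    · rintro ⟨t, h0, h1, y, hy, rfl⟩
      obtain ⟨z, rfl⟩ := hSr hy
      exact ⟨t • z, ⟨t, h0, h1, z, hy, by simp⟩, by simp [ι]⟩
    · rintro ⟨_, ⟨t, h0, h1, z, hz, rfl⟩, rfl⟩
      exact ⟨t, h0, h1, ι z, hz, by simp [ι]⟩
  rw [hcone, hι.euclideanHausdorffMeasure_image, ← hS', hι.euclideanHausdorffMeasure_image, hS']
  refine (hausdorff_openCone_le_of_hyperplane hfin hu (hι.continuous.measurable hS) ?_).trans ?_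
  · intro y hy
    obtain ⟨z, hz, hfz⟩ := hhull _ (hSv hy)
    have : z = y := hι.injective hz
    subst this
    rw [hun, inv_pow]
    exact (real_inner_smul_left w z _).trans (by rw [hw, hfz, mul_one])
  · gcongr

/-! ## Multiplicities -/

lemma mem_convexHull_range_iff {ι : Type*} [Fintype ι] {v : ι → E3} {x : E3} :
    x ∈ convexHull ℝ (Set.range v) ↔
      ∃ c : ι → ℝ, (∀ i, 0 ≤ c i) ∧ ∑ i, c i = 1 ∧ ∑ i, c i • v i = x := by
  classical
  constructor
  · intro hx
    refine convexHull_min (s := Set.range v) (t := {x | ∃ c : ι → ℝ, (∀ i, 0 ≤ c i) ∧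
      ∑ i, c i = 1 ∧ ∑ i, c i • v i = x}) ?_ ?_ hx
    · rintro _ ⟨i, rfl⟩
      refine ⟨Pi.single i 1, fun l => ?_, by simp, ?_⟩
      · by_cases h : l = i
        · subst h; simp
        · simp [h]
      · rw [Finset.sum_eq_single i] <;> simp +contextual
    · rintro _ ⟨c, hc, hc1, rfl⟩ _ ⟨e, he, he1, rfl⟩ s t hs ht hst
      refine ⟨s • c + t • e, fun i => ?_, ?_, ?_⟩
      · have := hc i; have := he i
        simp only [Pi.add_apply, Pi.smul_apply, smul_eq_mul]
        positivity
      · simp [Finset.sum_add_distrib, ← Finset.mul_sum, hc1, he1, hst]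
      · simp [add_smul, Finset.sum_add_distrib, Finset.smul_sum, mul_smul]
  · rintro ⟨c, hc, hc1, rfl⟩
    exact (convex_convexHull ℝ _).sum_mem (fun i _ => hc i) hc1
      fun i _ => subset_convexHull ℝ _ ⟨i, rfl⟩

lemma sub_mem_of_mem_convexHull {ι : Type*} {v : ι → E3} {q : E3} {W : Submodule ℝ E3}
    (h : ∀ i, v i - q ∈ W) {y : E3} (hy : y ∈ convexHull ℝ (Set.range v)) : y - q ∈ W := by
  refine convexHull_min (s := Set.range v) (t := {y | y - q ∈ W}) ?_ ?_ hy
  · rintro _ ⟨i, rfl⟩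
    exact h i
  · intro y hy z hz s t _ _ hst
    have : s • y + t • z - q = s • (y - q) + t • (z - q) := by
      have : q = (s + t) • q := by rw [hst, one_smul]
      nth_rewrite 1 [this]
      module
    show s • y + t • z - q ∈ W
    rw [this]
    exact W.add_mem (W.smul_mem _ hy) (W.smul_mem _ hz)

lemma Cell.isCompact_carrier {j : ℕ} (σ : Cell j) : IsCompact σ.carrier :=
  (Set.finite_range σ.1).isCompact_convexHull ℝ

lemma Chain.multiplicity_zero {j : ℕ} (x : E3) : (0 : Chain j).multiplicity x = 0 :=
  Finsupp.sum_zero_index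

lemma Chain.multiplicity_single {j : ℕ} (σ : Cell j) (a : ZMod 2) (x : E3) :
    Chain.multiplicity (Finsupp.single σ a) x = σ.carrier.indicator (fun _ => a) x :=
  Finsupp.sum_single_index (by simp)

lemma Chain.multiplicity_sum {j : ℕ} {ι : Type*} (s : Finset ι) (f : ι → Chain j) (x : E3) :
    (∑ i ∈ s, f i).multiplicity x = ∑ i ∈ s, (f i).multiplicity x := by
  classical
  induction s using Finset.induction_on with
  | empty => simp [Chain.multiplicity_zero]
  | insert a s ha ih => rw [Finset.sum_insert ha, Finset.sum_insert ha, multiplicity_add, ih]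

lemma Chain.multiplicity_mapCells {i j : ℕ} (f : Cell i → Cell j) (c : Chain i) (x : E3) :
    Chain.multiplicity (Finsupp.linearCombination (ZMod 2) (fun σ => Finsupp.single (f σ) 1) c) x =
      ∑ σ ∈ c.support, (f σ).carrier.indicator (fun _ => c σ) x := by
  rw [Finsupp.linearCombination_apply, Finsupp.sum, Chain.multiplicity_sum]
  refine Finset.sum_congr rfl fun σ _ => ?_
  rw [Finsupp.smul_single, smul_eq_mul, mul_one, Chain.multiplicity_single]

/-- If the points of the image cells over `x` correspond to unique points of the cells that satisfy
`P`, then `x` has an odd multiplicity only if such a point has. -/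
lemma Chain.exists_multiplicity_ne_zero {i j : ℕ} {f : Cell i → Cell j} {c : Chain i} {x : E3}
    {P : E3 → Prop} (h : ∀ σ ∈ c.support, x ∈ (f σ).carrier ↔ ∃ y ∈ σ.carrier, P y)
    (hu : ∀ σ ∈ c.support, ∀ y ∈ σ.carrier, ∀ z ∈ σ.carrier, P y → P z → y = z)
    (hx : Chain.multiplicity (Finsupp.linearCombination (ZMod 2)
      (fun σ => Finsupp.single (f σ) 1) c) x ≠ 0) :
    ∃ y, P y ∧ c.multiplicity y ≠ 0 := by
  classical
  by_contra! hn
  refine hx ?_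
  rw [Chain.multiplicity_mapCells]
  simp only [Set.indicator_apply]
  rw [← Finset.sum_filter]
  have hy : ∀ σ : Cell i, ∃ y : E3, σ ∈ c.support.filter (fun σ => x ∈ (f σ).carrier) →
      y ∈ σ.carrier ∧ P y := by
    intro σ
    by_cases hσ : σ ∈ c.support.filter (fun σ => x ∈ (f σ).carrier)
    · rw [Finset.mem_filter] at hσ
      obtain ⟨y, hy⟩ := (h σ hσ.1).1 hσ.2
      exact ⟨y, fun _ => hy⟩
    · exact ⟨0, fun h => absurd h hσ⟩
  choose Y hY using hy
  -- Group the cells whose images contain `x` by their point `Y σ` over `x`. By uniqueness the group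
  -- of `y` consists of exactly the cells through `y`, so it contributes the multiplicity of `c` at
  -- `y`.
  rw [← Finset.sum_fiberwise_of_maps_to (g := Y) (fun σ hσ => Finset.mem_image_of_mem Y hσ)]
  refine Finset.sum_eq_zero fun y hy => ?_
  obtain ⟨τ, hτ, rfl⟩ := Finset.mem_image.1 hy
  have hP := (hY τ hτ).2
  rw [← hn _ hP, Chain.multiplicity, Finsupp.sum]
  simp only [Set.indicator_apply]
  rw [← Finset.sum_filter, Finset.filter_filter]
  refine Finset.sum_congr (Finset.filter_congr fun σ hσ => ?_) fun _ _ => rfl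
  constructor
  · rintro ⟨h1, h2⟩
    rw [← h2]
    exact (hY σ (Finset.mem_filter.2 ⟨hσ, h1⟩)).1
  · intro h1
    have h2 := (h σ hσ).2 ⟨_, h1, hP⟩
    have h3 := hY σ (Finset.mem_filter.2 ⟨hσ, h2⟩)
    exact ⟨h2, hu σ hσ _ h3.1 _ h1 h3.2 hP⟩

lemma Chain.measurableSet_oddSet {j : ℕ} (c : Chain j) :
    MeasurableSet {x : E3 | c.multiplicity x ≠ 0} := by
  have h2 : ∀ a b : ZMod 2, a + b ≠ 0 ↔ (a ≠ 0 ∧ ¬ b ≠ 0) ∨ (b ≠ 0 ∧ ¬ a ≠ 0) := by decide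
  induction c using Finsupp.induction_linear with
  | zero => simp [Chain.multiplicity_zero]
  | add f g hf hg =>
    have : {x : E3 | Chain.multiplicity (f + g) x ≠ 0} =
        ({x | Chain.multiplicity f x ≠ 0} \ {x | Chain.multiplicity g x ≠ 0}) ∪
        ({x | Chain.multiplicity g x ≠ 0} \ {x | Chain.multiplicity f x ≠ 0}) := by
      ext x
      have := h2 (Chain.multiplicity f x) (Chain.multiplicity g x)
      rw [← Chain.multiplicity_add] at this
      exact this
    rw [this]
    exact (hf.diff hg).union (hg.diff hf)
  | single σ a =>
    simp only [Chain.multiplicity_single]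
    by_cases ha : a = 0
    · simp [ha]
    · have : {x : E3 | σ.carrier.indicator (fun _ => a) x ≠ 0} = σ.carrier := by
        ext x
        by_cases hx : x ∈ σ.carrier <;> simp [hx, ha]
      rw [this]
      exact σ.isCompact_carrier.measurableSet

lemma Chain.mass_eq_zero_iff {j : ℕ} (c : Chain j) :
    c.mass = 0 ↔ (Measure.euclideanHausdorffMeasure (j - 1) : Measure E3)
      {x : E3 | c.multiplicity x ≠ 0} = 0 := by
  rw [Chain.mass, ENNReal.toReal_eq_zero_iff]
  simp [c.measure_oddSet_ne_top]

lemma Chain.mass_sum_eq_zero {j : ℕ} {ι : Type*} (s : Finset ι) (f : ι → Chain j)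
    (h : ∀ i ∈ s, (f i).mass = 0) : (∑ i ∈ s, f i).mass = 0 := by
  classical
  induction s using Finset.induction_on with
  | empty => exact Chain.mass_zero
  | insert a s ha ih =>
    rw [Finset.sum_insert ha]
    have h1 := Chain.mass_add_le (f a) (∑ i ∈ s, f i)
    rw [h a (Finset.mem_insert_self _ _), ih fun i hi => h i (Finset.mem_insert_of_mem hi)] at h1
    exact le_antisymm (by simpa using h1) (Chain.mass_nonneg _)

lemma Chain.add_self {j : ℕ} (c : Chain j) : c + c = 0 := by
  nth_rewrite 1 [← Chain.neg_eq c]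
  exact neg_add_cancel c

instance instSubsingletonChainZero : Subsingleton (Chain 0) :=
  ⟨fun _ _ => Finsupp.ext fun σ => absurd σ.2 (lt_irrefl _)⟩

/-! ## The mass of a cone -/

lemma openCone_union {V : Type*} [AddCommGroup V] [Module ℝ V] (p : V) (S T : Set V) :
    openCone p (S ∪ T) = openCone p S ∪ openCone p T := by
  ext x
  constructor
  · rintro ⟨t, h0, h1, y, hy | hy, rfl⟩
    exacts [Or.inl ⟨t, h0, h1, y, hy, rfl⟩, Or.inr ⟨t, h0, h1, y, hy, rfl⟩]
  · rintro (⟨t, h0, h1, y, hy, rfl⟩ | ⟨t, h0, h1, y, hy, rfl⟩)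
    exacts [⟨t, h0, h1, y, Or.inl hy, rfl⟩, ⟨t, h0, h1, y, Or.inr hy, rfl⟩]

/-- The cells may overlap, so the part of `S` in one cell is split off at each step; the pieces of
`S` are disjoint, while subadditivity suffices for their cones. -/
lemma hausdorff_openCone_inter_biUnion_le {d : ℕ} (p : E3) {R : ℝ} (s : Finset (Cell (d + 1)))
    (hs : ∀ σ ∈ s, LinearIndependent ℝ (fun i => σ.1 i - p) ∧ ∀ x ∈ σ.carrier, dist x p ≤ R)
    {S : Set E3} (hS : MeasurableSet S) :
    (Measure.euclideanHausdorffMeasure (d + 1) : Measure E3)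
        (openCone p (S ∩ ⋃ σ ∈ s, σ.carrier)) ≤
      ENNReal.ofReal (R / (d + 1)) *
        (Measure.euclideanHausdorffMeasure d : Measure E3) (S ∩ ⋃ σ ∈ s, σ.carrier) := by
  classical
  induction s using Finset.induction_on generalizing S with
  | empty => simp [openCone]
  | insert τ s hτ ih =>
    have hm := τ.isCompact_carrier.measurableSet
    have e : S ∩ ⋃ σ ∈ insert τ s, σ.carrier =
        (S ∩ τ.carrier) ∪ ((S \ τ.carrier) ∩ ⋃ σ ∈ s, σ.carrier) := by
      rw [Finset.set_biUnion_insert]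
      ext x
      simp only [Set.mem_inter_iff, Set.mem_union, Set.mem_sdiff]
      tauto
    have hd : Disjoint (S ∩ τ.carrier) ((S \ τ.carrier) ∩ ⋃ σ ∈ s, σ.carrier) :=
      Set.disjoint_left.2 fun x hx hx' => hx'.1.2 hx.2
    rw [e, openCone_union, measure_union' hd (hS.inter hm), mul_add]
    refine (measure_union_le _ _).trans (add_le_add ?_ ?_)
    · have := hs τ (Finset.mem_insert_self _ _)
      exact hausdorff_openCone_le p this.1 this.2 (hS.inter hm) Set.inter_subset_right
    · exact ih (fun σ hσ => hs σ (Finset.mem_insert_of_mem hσ)) (hS.diff hm)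

lemma mem_cone_carrier_iff {j : ℕ} {p x : E3} (hx : x ≠ p) (σ : Cell j) :
    x ∈ (σ.cone p).carrier ↔ ∃ y ∈ σ.carrier, ∃ t : ℝ, 0 < t ∧ t ≤ 1 ∧ x = p + t • (y - p) := by
  have : Nonempty (Fin j) := ⟨⟨0, σ.2⟩⟩
  rw [Cell.carrier, Cell.cone, Fin.range_cons, convexHull_insert (Set.range_nonempty _)]
  simp only [convexJoin_singleton_left, Set.mem_iUnion, exists_prop, segment_eq_image']
  constructor
  · rintro ⟨y, hy, t, ⟨h0, h1⟩, rfl⟩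
    refine ⟨y, hy, t, lt_of_le_of_ne h0 ?_, h1, rfl⟩
    rintro rfl
    exact hx (by simp)
  · rintro ⟨y, hy, t, h0, h1, rfl⟩
    exact ⟨y, hy, t, ⟨h0.le, h1⟩, rfl⟩

/-- Off a null set, a ray from `p` meets each cell at most once. The multiplicity of the cone at `x`
is then the sum of the multiplicities of `c` at the points of the ray from `x` outwards, so an odd
point of the cone lies in the open cone over the odd set of `c`. -/
lemma Chain.mass_cone_le {d : ℕ} (p : E3) {R : ℝ} (hR0 : 0 ≤ R) (c : Chain (d + 1))
    (hR : ∀ x ∈ c.carrier, dist x p ≤ R) :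
    (Chain.cone p (d + 1) c).mass ≤ R / (d + 1) * c.mass := by
  classical
  set good := c.support.filter (fun σ => LinearIndependent ℝ (fun i => σ.1 i - p))
  set bad := c.support.filter (fun σ => ¬ LinearIndependent ℝ (fun i => σ.1 i - p))
  -- The cells for which the vectors from `p` to the `d + 1` vertices are dependent have cones in
  -- subspaces of dimension at most `d`, negligible for the `(d + 1)`-dimensional measure.
  let N : Set E3 := {p} ∪ ⋃ σ ∈ bad, {x | x - p ∈ Submodule.span ℝ (Set.range fun i => σ.1 i - p)}
  have hN : (Measure.euclideanHausdorffMeasure (d + 1) : Measure E3) N = 0 := by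
    refine measure_union_null ?_ ((measure_biUnion_null_iff bad.countable_toSet).2 fun σ hσ => ?_)
    · refine hausdorff_eq_zero_of_span p (fun i : Fin 0 => i.elim0) (Or.inl (by simp)) ?_
      rintro x rfl
      simp
    · refine hausdorff_eq_zero_of_span p (fun i => σ.1 i - p)
        (Or.inr ⟨by simp, (Finset.mem_filter.1 hσ).2⟩) fun x hx => hx
  have hmem : ∀ σ : Cell (d + 1), ∀ y ∈ σ.carrier,
      y - p ∈ Submodule.span ℝ (Set.range fun i => σ.1 i - p) := fun σ y hy =>
    sub_mem_of_mem_convexHull (fun i => Submodule.subset_span (Set.mem_range_self i)) hy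
  have hbad' : ∀ x, x ∉ N → ∀ σ ∈ bad, ∀ y ∈ σ.carrier, ∀ t : ℝ, x ≠ p + t • (y - p) := by
    rintro x hx σ hσ y hy t rfl
    refine hx (Or.inr (Set.mem_biUnion hσ ?_))
    show p + t • (y - p) - p ∈ Submodule.span ℝ (Set.range fun i => σ.1 i - p)
    rw [add_sub_cancel_left]
    exact Submodule.smul_mem _ _ (hmem σ y hy)
  have hsub : {x : E3 | (Chain.cone p (d + 1) c).multiplicity x ≠ 0} ⊆
      N ∪ openCone p ({x | c.multiplicity x ≠ 0} ∩ ⋃ σ ∈ good, σ.carrier) := by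
    intro x hx
    by_cases hxN : x ∈ N
    · exact Or.inl hxN
    right
    have hxp : x ≠ p := fun h => hxN (Or.inl h)
    have hu : ∀ σ ∈ c.support, ∀ y ∈ σ.carrier, ∀ z ∈ σ.carrier,
        (∃ t : ℝ, 0 < t ∧ t ≤ 1 ∧ x = p + t • (y - p)) →
        (∃ t : ℝ, 0 < t ∧ t ≤ 1 ∧ x = p + t • (z - p)) → y = z := by
      rintro σ hσ y hy z hz ⟨t, ht0, ht1, hxt⟩ ⟨s, hs0, hs1, hxs⟩
      by_cases hg : LinearIndependent ℝ (fun i => σ.1 i - p)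
      -- A functional equal to one on all vectors from `p` to the vertices is one on the whole cell,
      -- so it determines the parameter `t` along a ray.
      · obtain ⟨f, hf⟩ := LinearMap.exists_extend ((Module.Basis.span hg).constr ℝ fun _ => (1 : ℝ))
        have hf1 : ∀ i, f (σ.1 i - p) = 1 := fun i => by
          have := LinearMap.congr_fun hf (Module.Basis.span hg i)
          rw [LinearMap.comp_apply, Module.Basis.constr_basis] at this
          rw [← this]
          congr 1
          exact (congrArg Subtype.val (Module.Basis.span_apply hg i)).symm
        have hfy : ∀ y ∈ σ.carrier, f (y - p) = 1 := by
          intro y hy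
          obtain ⟨a, _, ha, rfl⟩ := mem_convexHull_range_iff.1 hy
          have : ∑ i, a i • σ.1 i - p = ∑ i, a i • (σ.1 i - p) := by
            simp only [smul_sub, Finset.sum_sub_distrib, ← Finset.sum_smul, ha, one_smul]
          rw [this, map_sum]
          simp [hf1, ha]
        have h1 : t • (y - p) = s • (z - p) := add_left_cancel (hxt.symm.trans hxs)
        have h2 := congrArg f h1
        rw [map_smul, map_smul, hfy y hy, hfy z hz, smul_eq_mul, smul_eq_mul, mul_one, mul_one] at h2
        subst h2
        exact sub_left_injective (smul_right_injective _ ht0.ne' h1)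
      · exact absurd hxt (hbad' x hxN σ (Finset.mem_filter.2 ⟨hσ, hg⟩) y hy t)
    obtain ⟨y, ⟨t, h0, h1, rfl⟩, hy⟩ := Chain.exists_multiplicity_ne_zero
      (fun σ _ => mem_cone_carrier_iff hxp σ) hu hx
    refine ⟨t, h0, h1, y, ⟨hy, ?_⟩, rfl⟩
    have := c.oddSet_subset_carrier hy
    rw [Chain.carrier] at this
    simp only [Set.mem_iUnion] at this ⊢
    obtain ⟨σ, hσ, hyσ⟩ := this
    refine ⟨σ, ?_, hyσ⟩
    by_contra hng
    have : σ ∈ bad := Finset.mem_filter.2 ⟨hσ, fun h => hng (Finset.mem_filter.2 ⟨hσ, h⟩)⟩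
    exact hbad' _ hxN σ this y hyσ t rfl
  have hle : (Measure.euclideanHausdorffMeasure (d + 1) : Measure E3)
      {x : E3 | (Chain.cone p (d + 1) c).multiplicity x ≠ 0} ≤ ENNReal.ofReal (R / (d + 1)) *
      (Measure.euclideanHausdorffMeasure d : Measure E3) {x | c.multiplicity x ≠ 0} := by
    refine (measure_mono hsub).trans ((measure_union_le _ _).trans ?_)
    rw [hN, zero_add]
    refine (hausdorff_openCone_inter_biUnion_le (R := R) p good (fun σ hσ => ?_)
      c.measurableSet_oddSet).trans ?_
    · exact ⟨(Finset.mem_filter.1 hσ).2, fun x hx =>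
        hR x (Set.mem_biUnion (Finset.mem_filter.1 hσ).1 hx)⟩
    · gcongr
      exact Set.inter_subset_left
  have hfin := c.measure_oddSet_ne_top
  simp only [Chain.mass, Nat.add_sub_cancel] at hfin ⊢
  refine (ENNReal.toReal_mono (ENNReal.mul_ne_top ENNReal.ofReal_ne_top hfin) hle).trans_eq ?_
  rw [ENNReal.toReal_mul, ENNReal.toReal_ofReal (by positivity)]

/-! ## Stellar subdivision -/

lemma Cell.range_cone_face {j : ℕ} (h : 0 < j) (σ : Cell (j + 1)) (b : E3) (i : Fin (j + 1)) :
    Set.range ((σ.face h i).cone b).1 = Set.range (Function.update σ.1 i b) := by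
  ext x
  simp only [Cell.cone, Cell.face, Fin.range_cons, Set.mem_insert_iff, Set.mem_range]
  constructor
  · rintro (rfl | ⟨m, rfl⟩)
    · exact ⟨i, by simp⟩
    · exact ⟨i.succAbove m, by simp [Fin.succAbove_ne]⟩
  · rintro ⟨l, rfl⟩
    by_cases hl : l = i
    · subst hl; simp
    · obtain ⟨m, rfl⟩ := Fin.exists_succAbove_eq hl
      right
      exact ⟨m, by simp [Fin.succAbove_ne]⟩

lemma Cell.mem_cone_face_iff {j : ℕ} (h : 0 < j) (σ : Cell (j + 1)) (b x : E3) (i : Fin (j + 1)) :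
    x ∈ ((σ.face h i).cone b).carrier ↔ ∃ c : Fin (j + 1) → ℝ, (∀ l, 0 ≤ c l) ∧ ∑ l, c l = 1 ∧
      ∑ l, c l • Function.update σ.1 i b l = x := by
  rw [Cell.carrier, Cell.range_cone_face, mem_convexHull_range_iff]

lemma hausdorff_carrier_eq_zero {d : ℕ} (σ : Cell (d + 1)) (h : ¬ AffineIndependent ℝ σ.1) :
    (Measure.euclideanHausdorffMeasure d : Measure E3) σ.carrier = 0 := by
  rw [affineIndependent_iff_linearIndependent_vsub ℝ σ.1 0] at h
  refine hausdorff_eq_zero_of_span (σ.1 0) _ (Or.inr ⟨by simp, h⟩) fun x hx => ?_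
  refine sub_mem_of_mem_convexHull (fun i => ?_) hx
  by_cases hi : i = 0
  · subst hi; simp
  · exact Submodule.subset_span ⟨⟨i, hi⟩, rfl⟩

lemma Cell.carrier_cone_face_subset {j : ℕ} (h : 0 < j) (σ : Cell (j + 1)) {b : E3}
    (hb : b ∈ σ.carrier) (i : Fin (j + 1)) : ((σ.face h i).cone b).carrier ⊆ σ.carrier := by
  refine convexHull_min ?_ (convex_convexHull ℝ _)
  rw [Cell.range_cone_face]
  rintro _ ⟨l, rfl⟩
  by_cases hl : l = i
  · subst hl; simpa using hb
  · rw [Function.update_of_ne hl]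
    exact subset_convexHull ℝ _ (Set.mem_range_self l)

/-- A cell is the union of the cones over its facets from one of its points. -/
lemma Cell.exists_mem_cone_face {j : ℕ} (h : 0 < j) (σ : Cell (j + 1)) {b x : E3}
    (hb : b ∈ σ.carrier) (hx : x ∈ σ.carrier) : ∃ i, x ∈ ((σ.face h i).cone b).carrier := by
  obtain ⟨β, hβ0, hβ1, rfl⟩ := mem_convexHull_range_iff.1 hb
  obtain ⟨ξ, hξ0, hξ1, rfl⟩ := mem_convexHull_range_iff.1 hx
  have hne : (Finset.univ.filter fun l => 0 < β l).Nonempty := by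
    by_contra hn
    have : ∀ l, β l = 0 := fun l => by
      refine le_antisymm (not_lt.1 fun hl => hn ⟨l, by simpa using hl⟩) (hβ0 l)
    simp [this] at hβ1
  -- The minimal ratio `t = ξ i / β i` is the largest multiple of `b` that can be subtracted from
  -- `x` with all barycentric coordinates staying nonnegative; the `i`-th one becomes zero, so what
  -- remains lies over the facet opposite vertex `i`.
  obtain ⟨i, hi, hmin⟩ := Finset.exists_min_image _ (fun l => ξ l / β l) hne
  have hi0 : 0 < β i := by simpa using hi
  set t := ξ i / β i with ht
  have ht0 : 0 ≤ t := div_nonneg (hξ0 i) hi0.le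
  have hle : ∀ l, t * β l ≤ ξ l := by
    intro l
    rcases (hβ0 l).eq_or_lt with h0 | h0
    · rw [← h0, mul_zero]; exact hξ0 l
    · rw [← le_div_iff₀ h0]
      exact hmin l (by simpa using h0)
  have hti : t * β i = ξ i := div_mul_cancel₀ _ hi0.ne'
  refine ⟨i, (σ.mem_cone_face_iff h _ _ i).2
    ⟨fun l => ξ l - t * β l + if l = i then t else 0, fun l => ?_, ?_, ?_⟩⟩
  · have := hle l
    dsimp only
    split_ifs <;> linarith
  · simp [Finset.sum_add_distrib, ← Finset.mul_sum, hξ1, hβ1]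
  · have : ∀ l, (ξ l - t * β l + if l = i then t else 0) •
        Function.update σ.1 i (∑ m, β m • σ.1 m) l =
        (ξ l • σ.1 l - t • β l • σ.1 l) + if l = i then t • ∑ m, β m • σ.1 m else 0 := by
      intro l
      by_cases hl : l = i
      · subst hl
        simp only [if_true, Function.update_self, hti, sub_self, zero_add, smul_smul]
      · simp only [hl, if_false, add_zero, Function.update_of_ne hl ]
        module
    simp only [this, Finset.sum_add_distrib, Finset.sum_sub_distrib, ← Finset.smul_sum]
    simp

/-- Let `e` and `f` be the coordinates of `x - b` from the two cones, with `e i = 0` and `f j = 0`.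
Affine independence forces `e - f = s β`, where `β` are the barycentric coordinates of `b`. If `s ≥
0` then `f i = -s β i ≤ 0`, so `f` vanishes at `i` too; if `s ≤ 0` then likewise `e j = 0`. Only `d`
edge vectors remain. -/
lemma Cell.mem_cone_face_unique {d : ℕ} (σ : Cell (d + 2)) {b x : E3} (hb : b ∈ σ.carrier)
    (hσ : AffineIndependent ℝ σ.1) {i j : Fin (d + 2)} (hij : i ≠ j)
    (hi : x ∈ ((σ.face d.succ_pos i).cone b).carrier)
    (hj : x ∈ ((σ.face d.succ_pos j).cone b).carrier) :
    x - b ∈ Submodule.span ℝ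
      ((((Finset.univ.erase i).erase j).image fun l => σ.1 l - b : Finset E3) : Set E3) := by
  have hcoord : ∀ i, x ∈ ((σ.face d.succ_pos i).cone b).carrier → ∃ e : Fin (d + 2) → ℝ,
      (∀ l, 0 ≤ e l) ∧ e i = 0 ∧ x - b = ∑ l, e l • (σ.1 l - b) := by
    intro i hi
    obtain ⟨c, hc0, hc1, rfl⟩ := (σ.mem_cone_face_iff d.succ_pos _ _ i).1 hi
    refine ⟨Function.update c i 0, fun l => ?_, by simp, ?_⟩
    · by_cases hl : l = i
      · subst hl; simp
      · simpa [hl] using hc0 l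
    · have : ∑ l, c l • Function.update σ.1 i b l - b =
          ∑ l, c l • (Function.update σ.1 i b l - b) := by
        simp only [smul_sub, Finset.sum_sub_distrib, ← Finset.sum_smul, hc1, one_smul]
      rw [this]
      refine Finset.sum_congr rfl fun l _ => ?_
      by_cases hl : l = i
      · subst hl; simp
      · simp [hl]
  obtain ⟨e, he0, hei, hex⟩ := hcoord i hi
  obtain ⟨f, hf0, hfj, hfx⟩ := hcoord j hj
  obtain ⟨β, hβ0, hβ1, hβ⟩ := mem_convexHull_range_iff.1 hb
  have hrel : ∀ l, e l - f l = (∑ m, (e m - f m)) * β l := by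
    have h1 : ∑ l, (e l - f l) • σ.1 l = (∑ m, (e m - f m)) • b := by
      have : ∑ l, (e l - f l) • (σ.1 l - b) = 0 := by
        simp only [sub_smul (e _), Finset.sum_sub_distrib]
        rw [← hex, ← hfx, sub_self]
      rw [← sub_eq_zero, ← this, Finset.sum_smul, ← Finset.sum_sub_distrib]
      simp only [smul_sub]
    intro l
    have h2 := affineIndependent_iff.1 hσ Finset.univ
      (fun l => (e l - f l) - (∑ m, (e m - f m)) * β l)
      (by rw [Finset.sum_sub_distrib, ← Finset.mul_sum, hβ1, mul_one, sub_self])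
      (by
        simp only [sub_smul _ (_ * _), mul_smul]
        rw [Finset.sum_sub_distrib, ← Finset.smul_sum, hβ, h1, sub_self]) l (Finset.mem_univ l)
    exact sub_eq_zero.1 h2
  have hspan : ∀ e : Fin (d + 2) → ℝ, e i = 0 → e j = 0 → ∑ l, e l • (σ.1 l - b) ∈
      Submodule.span ℝ
      ((((Finset.univ.erase i).erase j).image fun l => σ.1 l - b : Finset E3) : Set E3) := by
    intro e hi hj
    refine Submodule.sum_mem _ fun l _ => ?_
    by_cases hli : l = i
    · subst hli; simp [hi]
    by_cases hlj : l = j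
    · subst hlj; simp [hj]
    · refine Submodule.smul_mem _ _ (Submodule.subset_span ?_)
      exact Finset.mem_coe.2 (Finset.mem_image.2 ⟨l, by simp [hli, hlj], rfl⟩)
  set s := ∑ m, (e m - f m)
  have hri := hrel i
  have hrj := hrel j
  rw [hei] at hri
  rw [hfj] at hrj
  have := hf0 i; have := he0 j; have := hβ0 i; have := hβ0 j
  rcases le_total 0 s with hs | hs
  · rw [hfx]
    refine hspan f ?_ hfj
    nlinarith [mul_nonneg hs (hβ0 i)]
  · rw [hex]
    refine hspan e hei ?_
    nlinarith [mul_nonneg (neg_nonneg.2 hs) (hβ0 j)]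

/-- Almost every point of a nondegenerate simplex lies in exactly one of the cones over its facets,
and `1 + 1 = 0`; a degenerate simplex is itself a null set. -/
lemma Chain.mass_cone_boundary_add {d : ℕ} (σ : Cell (d + 2)) {b : E3} (hb : b ∈ σ.carrier) :
    (Chain.cone b (d + 1) (Cell.boundary σ) + Finsupp.single σ 1).mass = 0 := by
  have e : Chain.cone b (d + 1) (Cell.boundary σ) =
      ∑ i, Finsupp.single ((σ.face d.succ_pos i).cone b) 1 := by
    rw [Cell.boundary, dif_pos d.succ_pos, map_sum]
    refine Finset.sum_congr rfl fun i _ => ?_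
    simp [Chain.cone]
  have hm : ∀ x, Chain.multiplicity (Chain.cone b (d + 1) (Cell.boundary σ) +
      Finsupp.single σ 1) x = ∑ i, ((σ.face d.succ_pos i).cone b).carrier.indicator (fun _ => 1) x +
        σ.carrier.indicator (fun _ => 1) x := by
    intro x
    rw [e, Chain.multiplicity_add, Chain.multiplicity_sum]
    simp only [Chain.multiplicity_single]
  have hout : ∀ x, x ∉ σ.carrier → Chain.multiplicity (Chain.cone b (d + 1) (Cell.boundary σ) +
      Finsupp.single σ 1) x = 0 := by
    intro x hx
    rw [hm, Set.indicator_of_notMem hx, add_zero]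
    exact Finset.sum_eq_zero fun i _ => Set.indicator_of_notMem
      (fun h => hx (σ.carrier_cone_face_subset d.succ_pos hb i h)) _
  rw [Chain.mass_eq_zero_iff]
  by_cases hσ : AffineIndependent ℝ σ.1
  · let W : Fin (d + 2) → Fin (d + 2) → Submodule ℝ E3 := fun i j => Submodule.span ℝ
      ((((Finset.univ.erase i).erase j).image fun l => σ.1 l - b : Finset E3) : Set E3)
    refine measure_mono_null (t := ⋃ i, ⋃ j, ⋃ _ : i ≠ j, {x : E3 | x - b ∈ W i j}) ?_ ?_
    · intro x hx
      by_contra hn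
      simp only [Set.mem_iUnion, not_exists] at hn
      have hxσ : x ∈ σ.carrier := by
        by_contra h
        exact hx (hout x h)
      obtain ⟨i, hi⟩ := σ.exists_mem_cone_face d.succ_pos hb hxσ
      refine hx ?_
      rw [hm, Finset.sum_eq_single i, Set.indicator_of_mem hi, Set.indicator_of_mem hxσ]
      · decide
      · intro j _ hji
        refine Set.indicator_of_notMem (fun hj => ?_) _
        exact hn i j hji.symm (σ.mem_cone_face_unique hb hσ hji.symm hi hj)
      · simp
    · refine measure_iUnion_null fun i => measure_iUnion_null fun j => measure_iUnion_null fun hij => ?_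
      refine hausdorff_eq_zero_of_finrank_lt b (W i j) ?_ fun x hx => hx
      refine (finrank_span_finset_le_card _).trans_lt (Finset.card_image_le.trans_lt ?_)
      rw [Finset.card_erase_of_mem (by simp [hij.symm]), Finset.card_erase_of_mem (by simp),
        Finset.card_univ, Fintype.card_fin]
      omega
  · refine measure_mono_null (fun x hx => ?_) (hausdorff_carrier_eq_zero σ hσ)
    by_contra h
    exact hx (hout x h)

/-! ## Boundaries of cones -/

lemma Chain.mem_support_linearCombination {i j : ℕ} {f : Cell i → Chain j} {c : Chain i}
    {τ : Cell j} (h : τ ∈ (Finsupp.linearCombination (ZMod 2) f c).support) :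
    ∃ σ ∈ c.support, τ ∈ (f σ).support := by
  by_contra! hn
  rw [Finsupp.mem_support_iff, Finsupp.linearCombination_apply, Finsupp.sum,
    Finsupp.finsetSum_apply] at h
  refine h (Finset.sum_eq_zero fun σ hσ => ?_)
  rw [Finsupp.smul_apply, Finsupp.notMem_support_iff.1 (hn σ hσ), smul_zero]

lemma Chain.mem_support_mapCells {i j : ℕ} {f : Cell i → Cell j} {c : Chain i} {τ : Cell j}
    (h : τ ∈ (Finsupp.linearCombination (ZMod 2)
      (fun σ => (Finsupp.single (f σ) 1 : Chain j)) c).support) :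
    ∃ σ ∈ c.support, τ = f σ := by
  classical
  obtain ⟨σ, hσ, hτ⟩ := Chain.mem_support_linearCombination h
  exact ⟨σ, hσ, by simpa using Finsupp.support_single_subset hτ⟩

lemma Chain.parity_add {j : ℕ} (c d : Chain j) : (c + d).parity = c.parity + d.parity := by
  classical
  unfold Chain.parity
  split_ifs
  · exact Finsupp.sum_add_index' (fun _ => rfl) fun _ _ _ => rfl
  · simp

lemma Chain.parity_zero {j : ℕ} : (0 : Chain j).parity = 0 := by
  simp [Chain.parity]

lemma Chain.parity_single {j : ℕ} (σ : Cell j) (a : ZMod 2) :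
    Chain.parity (Finsupp.single σ a) = if j = 1 then a else 0 := by
  unfold Chain.parity
  rw [Finsupp.sum_single_index rfl]

lemma Chain.parity_of_ne {j : ℕ} (h : j ≠ 1) (c : Chain j) : c.parity = 0 := if_neg h

lemma Cell.parity_boundary {j : ℕ} (σ : Cell (j + 1)) : (Cell.boundary σ).parity = 0 := by
  by_cases h : j = 1
  · subst h
    rw [Cell.boundary, dif_pos one_pos, Fin.sum_univ_two, Chain.parity_add, Chain.parity_single,
      Chain.parity_single]
    decide
  · exact Chain.parity_of_ne h _

lemma Chain.boundary_single {j : ℕ} (σ : Cell (j + 1)) (a : ZMod 2) :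
    Chain.boundary j (Finsupp.single σ a) = a • Cell.boundary σ :=
  Finsupp.linearCombination_single _ _ _

lemma Chain.cone_single (p : E3) {j : ℕ} (σ : Cell j) (a : ZMod 2) :
    Chain.cone p j (Finsupp.single σ a) = Finsupp.single (σ.cone p) a := by
  rw [Chain.cone, Finsupp.linearCombination_single, Finsupp.smul_single, smul_eq_mul, mul_one]

lemma Chain.parity_boundary {j : ℕ} (c : Chain (j + 1)) : (Chain.boundary j c).parity = 0 := by
  induction c using Finsupp.induction_linear with
  | zero => rw [map_zero, Chain.parity_zero]
  | add f g hf hg => rw [map_add, Chain.parity_add, hf, hg, add_zero]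
  | single σ a =>
    rw [Chain.boundary_single]
    obtain rfl | rfl : a = 0 ∨ a = 1 := by revert a; decide
    · rw [zero_smul, Chain.parity_zero]
    · rw [one_smul, Cell.parity_boundary]

/-- The cell all of whose vertices are `p`. -/
def pointCell (p : E3) (j : ℕ) : Cell (j + 1) := ⟨fun _ => p, j.succ_pos⟩

/-- The facet opposite `p` is `σ` and the others are the cones over the facets of `σ`. Over a point
the other facet is `p` itself, which `p(∂σ)` misses because the boundary of a point is zero; this is
the only case in which the last term is nonzero. -/
lemma Cell.boundary_cone (p : E3) {j : ℕ} (σ : Cell (j + 1)) :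
    Cell.boundary (σ.cone p) = Finsupp.single σ 1 + Chain.cone p j (Cell.boundary σ) +
      Finsupp.single (pointCell p j) (if j + 1 = 1 then 1 else 0) := by
  have h0 : (σ.cone p).face j.succ_pos 0 = σ := by
    apply Subtype.ext
    funext m
    simp [Cell.face, Cell.cone]
  rw [Cell.boundary, dif_pos j.succ_pos, Fin.sum_univ_succ, h0, add_assoc]
  congr 1
  rcases Nat.eq_zero_or_pos j with rfl | hj
  · rw [Subsingleton.elim (Cell.boundary σ) 0, map_zero,
      zero_add (Finsupp.single (pointCell p 0) _), if_pos rfl,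
      Finset.sum_eq_single 0 (by simp) (by simp)]
    congr 1
    apply Subtype.ext
    funext m
    rw [Subsingleton.elim (α := Fin 1) m 0]
    rfl
  · rw [if_neg (by omega), Finsupp.single_zero, add_zero, Cell.boundary, dif_pos hj, map_sum]
    refine Finset.sum_congr rfl fun i _ => ?_
    rw [Chain.cone_single]
    congr 1
    apply Subtype.ext
    obtain ⟨m, rfl⟩ : ∃ m, j = m + 1 := ⟨j - 1, by omega⟩
    funext l
    refine Fin.cases ?_ (fun l => ?_) l
    · simp [Cell.face, Cell.cone]
    · simp [Cell.face, Cell.cone]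

/-- The homotopy formula for cones over chains. -/
lemma Chain.boundary_cone (p : E3) {j : ℕ} (c : Chain (j + 1)) :
    Chain.boundary (j + 1) (Chain.cone p (j + 1) c) =
      c + Chain.cone p j (Chain.boundary j c) + Finsupp.single (pointCell p j) c.parity := by
  induction c using Finsupp.induction_linear with
  | zero => simp [Chain.parity_zero]
  | add f g hf hg =>
    rw [map_add, map_add, hf, hg, map_add, map_add, Chain.parity_add, Finsupp.single_add]
    abel
  | single σ a =>
    rw [Chain.cone_single, Chain.boundary_single, Chain.boundary_single, Cell.boundary_cone,
      Chain.parity_single, smul_add, smul_add, Finsupp.smul_single, Finsupp.smul_single, map_smul]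
    simp

/-! ## Subdivision by a plane -/

/-- The cell does not cross the plane `⟪u, x⟫ = a`. -/
def Cell.OneSided (u : E3) (a : ℝ) {j : ℕ} (σ : Cell j) : Prop :=
  (∀ i, inner ℝ u (σ.1 i) ≤ a) ∨ ∀ i, a ≤ inner ℝ u (σ.1 i)

lemma Cell.OneSided.of_subset {u : E3} {a : ℝ} {i j : ℕ} {σ : Cell i} {τ : Cell j}
    (h : σ.OneSided u a) (hτ : Set.range τ.1 ⊆ Set.range σ.1) : τ.OneSided u a := by
  refine h.imp (fun h m => ?_) fun h m => ?_ <;>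
  · obtain ⟨l, hl⟩ := hτ ⟨m, rfl⟩
    rw [← hl]
    exact h l

lemma Cell.oneSided_point (u : E3) (a : ℝ) (σ : Cell 1) : σ.OneSided u a := by
  refine (le_total (inner ℝ u (σ.1 0)) a).imp (fun h i => ?_) fun h i => ?_ <;>
  · rw [Subsingleton.elim i 0]; exact h

lemma Cell.oneSided_face {u : E3} {a : ℝ} {j : ℕ} {σ : Cell (j + 1)} (h : σ.OneSided u a)
    (hj : 0 < j) (i : Fin (j + 1)) : (σ.face hj i).OneSided u a := by
  refine h.of_subset ?_
  rintro _ ⟨m, rfl⟩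
  exact ⟨_, rfl⟩

lemma Cell.exists_cut {u : E3} {a : ℝ} {j : ℕ} {σ : Cell j} (h : ¬ σ.OneSided u a) :
    ∃ b ∈ σ.carrier, inner ℝ u b = a := by
  simp only [Cell.OneSided, not_or, not_forall, not_le] at h
  obtain ⟨⟨i, hi⟩, ⟨l, hl⟩⟩ := h
  have hmem : ∀ i, σ.1 i ∈ σ.carrier := fun i => subset_convexHull ℝ _ (Set.mem_range_self i)
  exact (convex_convexHull ℝ (Set.range σ.1)).isPreconnected.intermediate_value (hmem l) (hmem i)
    (f := fun x => inner ℝ u x) (by fun_prop) ⟨hl.le, hi.le⟩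

open Classical in
/-- A point where the cell meets the plane `⟪u, x⟫ = a`. -/
def Cell.cut (u : E3) (a : ℝ) {j : ℕ} (σ : Cell j) : E3 :=
  if h : ∃ b ∈ σ.carrier, inner ℝ u b = a then h.choose else 0

lemma Cell.cut_spec {u : E3} {a : ℝ} {j : ℕ} {σ : Cell j} (h : ¬ σ.OneSided u a) :
    σ.cut u a ∈ σ.carrier ∧ inner ℝ u (σ.cut u a) = a := by
  have := Cell.exists_cut h
  rw [Cell.cut, dif_pos this]
  exact this.choose_spec

open Classical in
/-- The subdivision of a cell by the plane `⟪u, x⟫ = a`. -/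
def Cell.subdivide (u : E3) (a : ℝ) : (j : ℕ) → Cell j → Chain j
  | 0, _ => 0
  | j + 1, σ => if σ.OneSided u a then Finsupp.single σ 1 else
      Chain.cone (σ.cut u a) j
        (Finsupp.linearCombination (ZMod 2) (Cell.subdivide u a j) (Cell.boundary σ))

/-- The subdivision of a chain by the plane `⟪u, x⟫ = a`. -/
def Chain.subdivide (u : E3) (a : ℝ) (j : ℕ) : Chain j →ₗ[ZMod 2] Chain j :=
  Finsupp.linearCombination (ZMod 2) (Cell.subdivide u a j)

section Subdivide

variable {u : E3} {a : ℝ}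

lemma Cell.subdivide_of_oneSided {j : ℕ} {σ : Cell j} (h : σ.OneSided u a) :
    Cell.subdivide u a j σ = Finsupp.single σ 1 := by
  cases j with
  | zero => exact Subsingleton.elim (α := Chain 0) _ _
  | succ j => exact if_pos h

lemma Cell.subdivide_of_not_oneSided {j : ℕ} {σ : Cell (j + 1)} (h : ¬ σ.OneSided u a) :
    Cell.subdivide u a (j + 1) σ =
      Chain.cone (σ.cut u a) j (Chain.subdivide u a j (Cell.boundary σ)) :=
  if_neg h

lemma Chain.subdivide_single {j : ℕ} (σ : Cell j) (x : ZMod 2) :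
    Chain.subdivide u a j (Finsupp.single σ x) = x • Cell.subdivide u a j σ :=
  Finsupp.linearCombination_single _ _ _

lemma Chain.subdivide_of_oneSided {j : ℕ} {c : Chain j} (h : ∀ σ ∈ c.support, σ.OneSided u a) :
    Chain.subdivide u a j c = c := by
  conv_rhs => rw [← Finsupp.sum_single c]
  rw [Chain.subdivide, Finsupp.linearCombination_apply]
  refine Finsupp.sum_congr fun σ hσ => ?_
  rw [Cell.subdivide_of_oneSided (h σ hσ), Finsupp.smul_single, smul_eq_mul, mul_one]

lemma Cell.mem_support_boundary {j : ℕ} {σ : Cell (j + 1)} {τ : Cell j}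
    (h : τ ∈ (Cell.boundary σ).support) : ∃ (hj : 0 < j) (i : _), τ = σ.face hj i := by
  classical
  have hj : 0 < j := τ.2
  rw [Cell.boundary, dif_pos hj] at h
  obtain ⟨i, _, hi⟩ := Finset.mem_biUnion.1 (Finsupp.support_finsetSum h)
  exact ⟨hj, i, by simpa using Finsupp.support_single_subset hi⟩

/-- The cone vertex lies on the plane, so adding it to a one-sided piece of a facet leaves the piece
one-sided; it also lies in `σ`, so the pieces do not leave `σ`. -/
lemma Cell.mem_support_subdivide {j : ℕ} {σ τ : Cell j}
    (h : τ ∈ (Cell.subdivide u a j σ).support) :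
    τ.OneSided u a ∧ ∀ i, τ.1 i ∈ σ.carrier := by
  classical
  induction j with
  | zero => exact absurd σ.2 (lt_irrefl _)
  | succ j ih =>
    by_cases hσ : σ.OneSided u a
    · rw [Cell.subdivide_of_oneSided hσ] at h
      obtain rfl : τ = σ := by simpa using Finsupp.support_single_subset h
      exact ⟨hσ, fun i => subset_convexHull ℝ _ (Set.mem_range_self i)⟩
    · rw [Cell.subdivide_of_not_oneSided hσ] at h
      obtain ⟨ρ, hρ, rfl⟩ := Chain.mem_support_mapCells h
      obtain ⟨π, hπ, hρπ⟩ := Chain.mem_support_linearCombination hρ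
      obtain ⟨hj, i, rfl⟩ := Cell.mem_support_boundary hπ
      obtain ⟨h1, h2⟩ := ih hρπ
      obtain ⟨h3, h4⟩ := Cell.cut_spec hσ
      constructor
      · refine h1.imp (fun h m => ?_) fun h m => ?_
        · refine Fin.cases ?_ (fun m => ?_) m
          · exact h4.le
          · exact h m
        · refine Fin.cases ?_ (fun m => ?_) m
          · exact h4.ge
          · exact h m
      · intro m
        refine Fin.cases h3 (fun m => ?_) m
        refine convexHull_mono ?_ (h2 m)
        rintro _ ⟨l, rfl⟩
        exact ⟨_, rfl⟩

lemma Chain.parity_subdivide {j : ℕ} (c : Chain j) : (Chain.subdivide u a j c).parity = c.parity := by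
  by_cases hj : j = 1
  · subst hj
    rw [Chain.subdivide_of_oneSided fun σ _ => Cell.oneSided_point u a σ]
  · rw [Chain.parity_of_ne hj, Chain.parity_of_ne hj]

/-- For a crossing cell with cone vertex `b` and subdivision `s`, the homotopy formula gives `∂(b
s(∂σ)) = s(∂σ) + b ∂s(∂σ)`, and the last term is `b s(∂∂σ) = 0` by induction. There is no parity
term, since subdivision preserves parity and boundaries are even. -/
lemma Chain.boundary_subdivide {j : ℕ} (c : Chain (j + 1)) :
    Chain.boundary j (Chain.subdivide u a (j + 1) c) = Chain.subdivide u a j (Chain.boundary j c) := by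
  induction j with
  | zero => exact Subsingleton.elim _ _
  | succ j ih =>
    induction c using Finsupp.induction_linear with
    | zero => simp
    | add f g hf hg => rw [map_add, map_add, hf, hg, map_add, map_add]
    | single σ x =>
      rw [Chain.subdivide_single, map_smul, Chain.boundary_single, map_smul]
      congr 1
      by_cases hσ : σ.OneSided u a
      · rw [Cell.subdivide_of_oneSided hσ, Chain.boundary_single, one_smul,
          Chain.subdivide_of_oneSided]
        intro τ hτ
        obtain ⟨hj, i, rfl⟩ := Cell.mem_support_boundary hτ
        exact Cell.oneSided_face hσ hj i
      · rw [Cell.subdivide_of_not_oneSided hσ, Chain.boundary_cone, ih, Cell.boundary_boundary,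
          map_zero, map_zero, Chain.parity_subdivide, Cell.parity_boundary, Finsupp.single_zero,
          add_zero, add_zero]

lemma Chain.isBounded_carrier {j : ℕ} (c : Chain j) : Bornology.IsBounded c.carrier :=
  (Bornology.isBounded_biUnion c.support.finite_toSet).2 fun σ _ => σ.isCompact_carrier.isBounded

lemma Chain.mass_cone_eq_zero (p : E3) {j : ℕ} {c : Chain j} (h : c.mass = 0) :
    (Chain.cone p j c).mass = 0 := by
  cases j with
  | zero => rw [Subsingleton.elim c 0, map_zero, Chain.mass_zero]
  | succ d =>
    obtain ⟨R, hR⟩ := c.isBounded_carrier.subset_closedBall p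
    have := Chain.mass_cone_le p (le_max_right R 0) c fun x hx => (hR hx).trans (le_max_left R 0)
    rw [h, mul_zero] at this
    exact le_antisymm this (Chain.mass_nonneg _)

lemma Chain.subdivide_add_self {j : ℕ} (c : Chain j) : Chain.subdivide u a j c + c =
    ∑ σ ∈ c.support, (Cell.subdivide u a j σ + Finsupp.single σ 1) := by
  have h1 : ∀ x : ZMod 2, x ≠ 0 → x = 1 := by decide
  rw [Finset.sum_add_distrib]
  congr 1
  · rw [Chain.subdivide, Finsupp.linearCombination_apply, Finsupp.sum]
    refine Finset.sum_congr rfl fun σ hσ => ?_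
    rw [h1 _ (Finsupp.mem_support_iff.1 hσ), one_smul]
  · conv_lhs => rw [← Finsupp.sum_single c]
    refine Finset.sum_congr rfl fun σ hσ => ?_
    rw [h1 _ (Finsupp.mem_support_iff.1 hσ)]

lemma Chain.add_add_add_cancel {j : ℕ} (x y z : Chain j) : x + y + (y + z) = x + z := by
  rw [add_assoc, ← add_assoc y, Chain.add_self, zero_add]

/-- With `b` the cone vertex and `s` the subdivision, the chain is `b(s(∂σ) + ∂σ) + (b ∂σ + σ)`: the
first summand is a cone over a chain of mass zero by induction, the second is the stellar
subdivision of `σ`. -/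
lemma Cell.mass_subdivide_add {j : ℕ} (σ : Cell j) :
    (Cell.subdivide u a j σ + Finsupp.single σ 1).mass = 0 := by
  induction j with
  | zero => exact absurd σ.2 (lt_irrefl _)
  | succ j ih =>
    by_cases hσ : σ.OneSided u a
    · rw [Cell.subdivide_of_oneSided hσ, Chain.add_self, Chain.mass_zero]
    · obtain ⟨d, rfl⟩ : ∃ d, j = d + 1 := by
        cases j with
        | zero => exact absurd (Cell.oneSided_point u a σ) hσ
        | succ d => exact ⟨d, rfl⟩
      have h1 : (Chain.subdivide u a (d + 1) (Cell.boundary σ) + Cell.boundary σ).mass = 0 := by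
        rw [Chain.subdivide_add_self]
        exact Chain.mass_sum_eq_zero _ _ fun τ _ => ih τ
      have h2 := Chain.mass_cone_eq_zero (σ.cut u a) h1
      have h3 := Chain.mass_cone_boundary_add σ (Cell.cut_spec hσ).1
      have h4 := Chain.mass_add_le _ _ |>.trans_eq (congrArg₂ (· + ·) h2 h3)
      rw [map_add, Chain.add_add_add_cancel, add_zero (0 : ℝ),
        ← Cell.subdivide_of_not_oneSided hσ] at h4
      exact le_antisymm h4 (Chain.mass_nonneg _)

lemma Chain.mass_subdivide_le {j : ℕ} (c : Chain j) : (Chain.subdivide u a j c).mass ≤ c.mass := by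
  have h : (Chain.subdivide u a j c + c).mass = 0 := by
    rw [Chain.subdivide_add_self]
    exact Chain.mass_sum_eq_zero _ _ fun τ _ => Cell.mass_subdivide_add τ
  have h1 := Chain.mass_add_le (Chain.subdivide u a j c + c) c
  rwa [add_assoc, Chain.add_self, add_zero, h, zero_add] at h1

end Subdivide

/-! ## The projection onto a half-space -/

/-- The nearest point projection onto the half-space `⟪u, x⟫ ≤ a`, for a unit vector `u`. -/
def fold (u : E3) (a : ℝ) (x : E3) : E3 := x - max (inner ℝ u x - a) 0 • u

/-- The image of a cell under a map of its vertices. -/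
def Cell.map (g : E3 → E3) {j : ℕ} (σ : Cell j) : Cell j := ⟨g ∘ σ.1, σ.2⟩

/-- The image of a chain under a map of its vertices. -/
def Chain.map (g : E3 → E3) (j : ℕ) : Chain j →ₗ[ZMod 2] Chain j :=
  Finsupp.linearCombination (ZMod 2) (fun σ => Finsupp.single (σ.map g) 1)

lemma Chain.map_single (g : E3 → E3) {j : ℕ} (σ : Cell j) (a : ZMod 2) :
    Chain.map g j (Finsupp.single σ a) = Finsupp.single (σ.map g) a := by
  rw [Chain.map, Finsupp.linearCombination_single, Finsupp.smul_single, smul_eq_mul, mul_one]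

lemma Chain.boundary_map (g : E3 → E3) {j : ℕ} (c : Chain (j + 1)) :
    Chain.boundary j (Chain.map g (j + 1) c) = Chain.map g j (Chain.boundary j c) := by
  induction c using Finsupp.induction_linear with
  | zero => simp
  | add f g hf hg => rw [map_add, map_add, hf, hg, map_add, map_add]
  | single σ x =>
    rw [Chain.map_single, Chain.boundary_single, Chain.boundary_single, map_smul]
    congr 1
    rcases Nat.eq_zero_or_pos j with rfl | hj
    · exact Subsingleton.elim _ _
    · rw [Cell.boundary, Cell.boundary, dif_pos hj, dif_pos hj, map_sum]
      refine Finset.sum_congr rfl fun i _ => ?_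
      rw [Chain.map_single]
      rfl

section Fold

variable {u : E3} {a : ℝ}

lemma fold_of_le {x : E3} (h : inner ℝ u x ≤ a) : fold u a x = x := by
  rw [fold, max_eq_right (by linarith), zero_smul, sub_zero]

lemma fold_of_ge {x : E3} (h : a ≤ inner ℝ u x) : fold u a x = x - (inner ℝ u x - a) • u := by
  rw [fold, max_eq_left (by linarith)]

lemma inner_fold_le (hu : ‖u‖ = 1) (x : E3) : inner ℝ u (fold u a x) ≤ a := by
  rw [fold, inner_sub_right, inner_smul_right, real_inner_self_eq_norm_sq, hu]
  have := le_max_left (inner ℝ u x - a) 0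
  linarith

lemma lipschitzWith_fold (hu : ‖u‖ = 1) : LipschitzWith 1 (fold u a) := by
  refine LipschitzWith.of_dist_le_mul fun x y => ?_
  rw [NNReal.coe_one, one_mul, dist_eq_norm, dist_eq_norm]
  set s := max (inner ℝ u x - a) 0 with hs
  set t := max (inner ℝ u y - a) 0 with ht
  have e : fold u a x - fold u a y = (x - y) - (s - t) • u := by
    rw [fold, fold, sub_smul]; abel
  have h1 : ‖(x - y) - (s - t) • u‖ ^ 2 =
      ‖x - y‖ ^ 2 - 2 * ((s - t) * (inner ℝ u x - inner ℝ u y)) + (s - t) ^ 2 := by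
    rw [norm_sub_sq_real, norm_smul, hu, inner_smul_right, real_inner_comm, inner_sub_right]
    simp
  have h2 : (s - t) ^ 2 ≤ (s - t) * (inner ℝ u x - inner ℝ u y) := by
    rcases max_cases (inner ℝ u x - a) 0 with h | h <;>
      rcases max_cases (inner ℝ u y - a) 0 with h' | h' <;>
      rw [hs, ht, h.1, h'.1] <;> nlinarith
  rw [e]
  refine le_of_sq_le_sq ?_ (norm_nonneg _)
  nlinarith [sq_nonneg (s - t)]

/-- The orthogonal projection along `u`, the linear part of `fold u a` on `a ≤ ⟪u, x⟫`. -/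
def foldLinear (u : E3) : E3 →ₗ[ℝ] E3 :=
  LinearMap.id - (LinearMap.toSpanSingleton ℝ E3 u).comp (innerₗ E3 u)

lemma foldLinear_apply (x : E3) : foldLinear u x = x - (inner ℝ u x : ℝ) • u := by
  simp [foldLinear]

lemma convex_le_inner : Convex ℝ {x : E3 | a ≤ inner ℝ u x} :=
  convex_halfSpace_ge ((innerₗ E3 u).isLinear) a

lemma convex_inner_le : Convex ℝ {x : E3 | inner ℝ u x ≤ a} :=
  convex_halfSpace_le ((innerₗ E3 u).isLinear) a

/-- On either closed side of the plane the projection is affine, so the simplex spanned by the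
projected vertices is the image of the simplex. This fails for a crossing cell, hence the
subdivision. -/
lemma Cell.mem_map_fold_iff {j : ℕ} {σ : Cell j} (h : σ.OneSided u a) (x : E3) :
    x ∈ (σ.map (fold u a)).carrier ↔ ∃ y ∈ σ.carrier, fold u a y = x := by
  have key : ∀ (L : E3 →ₗ[ℝ] E3) (q : E3), (∀ y ∈ σ.carrier, fold u a y = L y + q) →
      (x ∈ (σ.map (fold u a)).carrier ↔ ∃ y ∈ σ.carrier, fold u a y = x) := by
    intro L q hL
    have hm : ∀ i, σ.1 i ∈ σ.carrier := fun i => subset_convexHull ℝ _ (Set.mem_range_self i)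
    have e : ∀ c : Fin j → ℝ, (∀ i, 0 ≤ c i) → ∑ i, c i = 1 →
        ∑ i, c i • fold u a (σ.1 i) = fold u a (∑ i, c i • σ.1 i) := by
      intro c hc hc1
      rw [hL _ (mem_convexHull_range_iff.2 ⟨c, hc, hc1, rfl⟩), map_sum]
      simp only [hL _ (hm _), smul_add, Finset.sum_add_distrib, ← Finset.sum_smul, hc1, one_smul,
        map_smul]
    rw [Cell.carrier, Cell.carrier, mem_convexHull_range_iff]
    constructor
    · rintro ⟨c, hc, hc1, rfl⟩
      exact ⟨_, mem_convexHull_range_iff.2 ⟨c, hc, hc1, rfl⟩, (e c hc hc1).symm⟩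
    · rintro ⟨y, hy, rfl⟩
      obtain ⟨c, hc, hc1, rfl⟩ := mem_convexHull_range_iff.1 hy
      exact ⟨c, hc, hc1, e c hc hc1⟩
  rcases h with h | h
  · refine key LinearMap.id 0 fun y hy => ?_
    have : inner ℝ u y ≤ a :=
      convexHull_min (by rintro _ ⟨i, rfl⟩; exact h i) convex_inner_le hy
    rw [fold_of_le this, LinearMap.id_apply, add_zero]
  · refine key (foldLinear u) (a • u) fun y hy => ?_
    have : a ≤ inner ℝ u y :=
      convexHull_min (by rintro _ ⟨i, rfl⟩; exact h i) convex_le_inner hy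
    rw [fold_of_ge this, foldLinear_apply]
    module

/-- Off a null set the projection is injective on each cell over the point considered, so an odd
point of the image chain is the image of an odd point of `c`; and a `1`-Lipschitz map does not
increase Hausdorff measure. -/
lemma Chain.mass_map_fold_le (hu : ‖u‖ = 1) {j : ℕ} {c : Chain j}
    (hc : ∀ σ ∈ c.support, σ.OneSided u a) : (Chain.map (fold u a) j c).mass ≤ c.mass := by
  classical
  cases j with
  | zero => rw [Subsingleton.elim (Chain.map (fold u a) 0 c) c]
  | succ d =>
  let w : Cell (d + 1) → Fin d → E3 := fun σ i => σ.1 i.succ - σ.1 0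
  set bad := c.support.filter (fun σ => (∀ i, a ≤ inner ℝ u (σ.1 i)) ∧
    ¬ LinearIndependent ℝ (foldLinear u ∘ w σ))
  -- The cells on the far side that are flattened: their `d` edge vectors become dependent under the
  -- projection, so their images have dimension less than `d`.
  let N : Set E3 := ⋃ σ ∈ bad,
    {x | x - fold u a (σ.1 0) ∈ Submodule.span ℝ (Set.range (foldLinear u ∘ w σ))}
  have hN : (Measure.euclideanHausdorffMeasure d : Measure E3) N = 0 := by
    refine (measure_biUnion_null_iff bad.countable_toSet).2 fun σ hσ => ?_
    exact hausdorff_eq_zero_of_span (fold u a (σ.1 0)) (foldLinear u ∘ w σ)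
      (Or.inr ⟨by simp, (Finset.mem_filter.1 hσ).2.2⟩) fun x hx => hx
  have hmem : ∀ σ : Cell (d + 1), ∀ y ∈ σ.carrier,
      y - σ.1 0 ∈ Submodule.span ℝ (Set.range (w σ)) := fun σ y hy => by
    refine sub_mem_of_mem_convexHull (fun i => ?_) hy
    refine Fin.cases (by simp) (fun i => ?_) i
    exact Submodule.subset_span (Set.mem_range_self i)
  have hge : ∀ σ : Cell (d + 1), (∀ i, a ≤ inner ℝ u (σ.1 i)) → ∀ y ∈ σ.carrier,
      ∀ z ∈ σ.carrier, fold u a y - fold u a z = foldLinear u (y - z) := by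
    intro σ h y hy z hz
    have h' : ∀ y ∈ σ.carrier, a ≤ inner ℝ u y := fun y hy =>
      convexHull_min (by rintro _ ⟨i, rfl⟩; exact h i) convex_le_inner hy
    rw [fold_of_ge (h' y hy), fold_of_ge (h' z hz), foldLinear_apply, inner_sub_right]
    module
  have hsub : {x : E3 | (Chain.map (fold u a) (d + 1) c).multiplicity x ≠ 0} ⊆
      N ∪ fold u a '' {x | c.multiplicity x ≠ 0} := by
    intro x hx
    by_cases hxN : x ∈ N
    · exact Or.inl hxN
    right
    have hun : ∀ σ ∈ c.support, ∀ y ∈ σ.carrier, ∀ z ∈ σ.carrier,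
        fold u a y = x → fold u a z = x → y = z := by
      intro σ hσ y hy z hz hyx hzx
      rcases hc σ hσ with h | h
      · have h' : ∀ y ∈ σ.carrier, inner ℝ u y ≤ a := fun y hy =>
          convexHull_min (by rintro _ ⟨i, rfl⟩; exact h i) convex_inner_le hy
        rw [← fold_of_le (h' y hy), ← fold_of_le (h' z hz), hyx, hzx]
      · have h0 : σ.1 0 ∈ σ.carrier := subset_convexHull ℝ _ (Set.mem_range_self _)
        by_cases hli : LinearIndependent ℝ (foldLinear u ∘ w σ)
        · have h1 : y - z ∈ Submodule.span ℝ (Set.range (w σ)) := by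
            rw [← sub_sub_sub_cancel_right y z (σ.1 0)]
            exact Submodule.sub_mem _ (hmem σ y hy) (hmem σ z hz)
          obtain ⟨e, he⟩ := (Submodule.mem_span_range_iff_exists_fun ℝ).1 h1
          have h2 : foldLinear u (y - z) = 0 := by
            rw [← hge σ h y hy z hz, hyx, hzx, sub_self]
          rw [← he, map_sum] at h2
          simp only [map_smul] at h2
          have h3 := Fintype.linearIndependent_iff.1 hli e h2
          rw [← sub_eq_zero, ← he]
          simp [h3]
        · refine absurd (Set.mem_biUnion (Finset.mem_filter.2 ⟨hσ, h, hli⟩) ?_) hxN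
          show x - fold u a (σ.1 0) ∈ Submodule.span ℝ (Set.range (foldLinear u ∘ w σ))
          rw [← hyx, hge σ h y hy _ h0, Set.range_comp, Submodule.span_image]
          exact Submodule.mem_map_of_mem (hmem σ y hy)
    obtain ⟨y, hyx, hy⟩ := Chain.exists_multiplicity_ne_zero
      (fun σ hσ => Cell.mem_map_fold_iff (hc σ hσ) x) hun hx
    exact ⟨y, hy, hyx⟩
  have hfin := c.measure_oddSet_ne_top
  simp only [Chain.mass, Nat.add_sub_cancel] at hfin ⊢
  refine ENNReal.toReal_mono hfin ((measure_mono hsub).trans ((measure_union_le _ _).trans ?_))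
  rw [hN, zero_add, Measure.euclideanHausdorffMeasure_def, Measure.smul_apply, Measure.smul_apply]
  have := (lipschitzWith_fold (a := a) hu).hausdorffMeasure_image_le (Nat.cast_nonneg d)
    {x | c.multiplicity x ≠ 0}
  rw [ENNReal.coe_one, ENNReal.one_rpow, one_mul] at this
  rw [ENNReal.smul_def, ENNReal.smul_def, smul_eq_mul, smul_eq_mul]
  gcongr

/-- The image of a chain under the projection onto a half-space. -/
def Chain.fold (u : E3) (a : ℝ) (j : ℕ) : Chain j →ₗ[ZMod 2] Chain j :=
  (Chain.map (Dipolyhedron.fold u a) j).comp (Chain.subdivide u a j)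

lemma Chain.boundary_fold {j : ℕ} (c : Chain (j + 1)) :
    Chain.boundary j (Chain.fold u a (j + 1) c) = Chain.fold u a j (Chain.boundary j c) := by
  rw [Chain.fold, Chain.fold, LinearMap.comp_apply, LinearMap.comp_apply, Chain.boundary_map,
    Chain.boundary_subdivide]

lemma Chain.mass_fold_le (hu : ‖u‖ = 1) {j : ℕ} (c : Chain j) :
    (Chain.fold u a j c).mass ≤ c.mass := by
  refine (Chain.mass_map_fold_le hu fun σ hσ => ?_).trans (Chain.mass_subdivide_le c)
  obtain ⟨τ, _, hτ⟩ := Chain.mem_support_linearCombination hσ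
  exact (Cell.mem_support_subdivide hτ).1

lemma Chain.carrier_fold_subset {j : ℕ} {c : Chain j} {K : Set E3} (hK : Convex ℝ K)
    (h : ∀ x ∈ c.carrier, Dipolyhedron.fold u a x ∈ K) : (Chain.fold u a j c).carrier ⊆ K := by
  refine Set.iUnion₂_subset fun τ hτ => convexHull_min ?_ hK
  obtain ⟨σ, hσ, rfl⟩ := Chain.mem_support_mapCells hτ
  obtain ⟨ρ, hρ, hσρ⟩ := Chain.mem_support_linearCombination hσ
  rintro _ ⟨i, rfl⟩
  exact h _ (Set.mem_biUnion hρ ((Cell.mem_support_subdivide hσρ).2 i))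

/-- The identity holds for formal sums, not only up to mass zero, because one-sided cells are not
subdivided. -/
lemma Chain.fold_eq_self {j : ℕ} {c : Chain j} (h : ∀ x ∈ c.carrier, inner ℝ u x ≤ a) :
    Chain.fold u a j c = c := by
  have h' : ∀ σ ∈ c.support, ∀ i, inner ℝ u (σ.1 i) ≤ a := fun σ hσ i =>
    h _ (Set.mem_biUnion hσ (subset_convexHull ℝ _ (Set.mem_range_self i)))
  rw [Chain.fold, LinearMap.comp_apply,
    Chain.subdivide_of_oneSided fun σ hσ => Or.inl (h' σ hσ)]
  conv_rhs => rw [← Finsupp.sum_single c]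
  rw [Chain.map, Finsupp.linearCombination_apply]
  refine Finsupp.sum_congr fun σ hσ => ?_
  rw [Finsupp.smul_single, smul_eq_mul, mul_one]
  congr 1
  exact Subtype.ext (funext fun i => fold_of_le (h' σ hσ i))

end Fold

/-! ## The retraction of chains onto a cube -/

/-- A mass-nonincreasing chain map that retracts the chains of `ℝ³` onto the chains in `K`. -/
structure Retraction (K : Set E3) where
  /-- The operator on chains. -/
  map : ∀ j, Chain j →ₗ[ZMod 2] Chain j
  boundary_map : ∀ j (c : Chain (j + 1)),
    Chain.boundary j (map (j + 1) c) = map j (Chain.boundary j c)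
  mass_map_le : ∀ j (c : Chain j), (map j c).mass ≤ c.mass
  carrier_map_subset : ∀ j (c : Chain j), (map j c).carrier ⊆ K
  map_eq_self : ∀ j (c : Chain j), c.carrier ⊆ K → map j c = c

lemma exists_retraction_inter {K : Set E3} (hK : Convex ℝ K) (h : Nonempty (Retraction K))
    {u : E3} (hu : ‖u‖ = 1) {a : ℝ} (hKu : ∀ x ∈ K, fold u a x ∈ K) :
    Nonempty (Retraction (K ∩ {x | inner ℝ u x ≤ a})) := by
  obtain ⟨F⟩ := h
  refine ⟨fun j => (Chain.fold u a j).comp (F.map j), fun j c => ?_, fun j c => ?_, fun j c => ?_,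
    fun j c hc => ?_⟩
  · rw [LinearMap.comp_apply, LinearMap.comp_apply, Chain.boundary_fold, F.boundary_map]
  · rw [LinearMap.comp_apply]
    exact (Chain.mass_fold_le hu _).trans (F.mass_map_le j c)
  · rw [LinearMap.comp_apply]
    exact Chain.carrier_fold_subset (hK.inter convex_inner_le) fun x hx =>
      ⟨hKu x (F.carrier_map_subset j c hx), inner_fold_le hu x⟩
  · rw [LinearMap.comp_apply, F.map_eq_self j c fun x hx => (hc hx).1]
    exact Chain.fold_eq_self fun x hx => (hc hx).2

/-- The cube is the intersection of six half-spaces, indexed by an axis and a sign. They are imposed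
one at a time; each projection preserves the conditions already imposed, so the retractions compose.
-/
lemma exists_retraction_cube (p : E3) {r : ℝ} (hr : 0 < r) : Nonempty (Retraction (cube p r)) := by
  classical
  let K : Finset (Fin 3 × ℤˣ) → Set E3 := fun s => {x | ∀ q ∈ s, ((q.2 : ℤ) : ℝ) * (x q.1 - p q.1) ≤ r / 2}
  have hsq : ∀ e : ℤˣ, ((e : ℤ) : ℝ) * ((e : ℤ) : ℝ) = 1 := fun e => by
    rcases Int.units_eq_one_or e with rfl | rfl <;> norm_num
  have hconv : ∀ s, Convex ℝ (K s) := by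
    intro s x hx y hy α β hα hβ hαβ q hq
    have h1 := mul_le_mul_of_nonneg_left (hx q hq) hα
    have h2 := mul_le_mul_of_nonneg_left (hy q hq) hβ
    have h3 : ((q.2 : ℤ) : ℝ) * ((α • x + β • y) q.1 - p q.1) =
        α * (((q.2 : ℤ) : ℝ) * (x q.1 - p q.1)) + β * (((q.2 : ℤ) : ℝ) * (y q.1 - p q.1)) := by
      simp only [PiLp.add_apply, PiLp.smul_apply, smul_eq_mul]
      linear_combination ((q.2 : ℤ) : ℝ) * p q.1 * hαβ
    rw [h3]
    calc _ ≤ α * (r / 2) + β * (r / 2) := add_le_add h1 h2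
      _ = r / 2 := by rw [← add_mul, hαβ, one_mul]
  have hK : ∀ s, Nonempty (Retraction (K s)) := by
    intro s
    induction s using Finset.induction_on with
    | empty =>
      exact ⟨fun _ => LinearMap.id, fun _ _ => rfl, fun _ _ => le_rfl,
        fun _ _ _ _ _ h => absurd h (Finset.notMem_empty _), fun _ _ _ => rfl⟩
    | insert q s hq ih =>
      obtain ⟨i, e⟩ := q
      let u : E3 := EuclideanSpace.single i ((e : ℤ) : ℝ)
      have hinner : ∀ x : E3, inner ℝ u x = ((e : ℤ) : ℝ) * x i := fun x => by
        simp [u, EuclideanSpace.inner_single_left]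
      have hu : ‖u‖ = 1 := by
        rw [PiLp.norm_single, Real.norm_eq_abs, ← abs_one, ← sq_eq_sq_iff_abs_eq_abs, sq,
          hsq, one_pow]
      let a := ((e : ℤ) : ℝ) * p i + r / 2
      have e1 : K (insert (i, e) s) = K s ∩ {x | inner ℝ u x ≤ a} := by
        ext x
        simp only [K, Finset.forall_mem_insert, Set.mem_inter_iff, Set.mem_ofPred_eq, hinner, a]
        rw [and_comm, mul_sub, sub_le_iff_le_add']
      rw [e1]
      refine exists_retraction_inter (hconv s) ih hu fun x hx => ?_
      rintro ⟨l, f⟩ hlf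
      have hxl := hx _ hlf
      rw [fold, hinner]
      set t := max (((e : ℤ) : ℝ) * x i - a) 0 with ht
      have hx' : (x - t • u) l = x l - t * (if l = i then ((e : ℤ) : ℝ) else 0) := by
        simp [u]
      simp only at hxl ⊢
      rw [hx']
      by_cases hl : l = i
      · subst hl
        rw [if_pos rfl]
        -- A point that moves lands on the face `(l, e)`, which satisfies the condition of the
        -- opposite face since `r > 0`. The other axes are untouched.
        rcases max_cases (((e : ℤ) : ℝ) * x l - a) 0 with h | h
        · rcases Int.units_eq_one_or e with rfl | rfl <;>
          rcases Int.units_eq_one_or f with rfl | rfl <;>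
          · simp only [a] at h ht
            rw [ht, h.1]
            push_cast at *
            linarith
        · rw [ht, h.1, zero_mul, sub_zero]
          exact hxl
      · rw [if_neg hl, mul_zero, sub_zero]
        exact hxl
  have hcube : cube p r = K Finset.univ := by
    ext x
    simp only [cube, K, Set.mem_ofPred_eq, Finset.mem_univ, true_implies, Prod.forall]
    refine forall_congr' fun i => ?_
    rw [abs_le]
    constructor
    · rintro ⟨h1, h2⟩ e
      rcases Int.units_eq_one_or e with rfl | rfl <;> push_cast <;> linarith
    · intro h
      have h1 := h 1
      have h2 := h (-1)
      push_cast at h1 h2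
      constructor <;> linarith
  rw [hcube]
  exact hK _

/-! ## Cones over dipolyhedra -/

section Parts

variable {k : ℕ}

lemma Dip.ext {D D' : Dip k} (h1 : Dip.dipolePart k D = Dip.dipolePart k D')
    (h2 : Dip.massPart k D = Dip.massPart k D') : D = D' :=
  Prod.ext h1 h2

lemma Dip.dipolePart_dipole (c : Chain (k + 1)) : Dip.dipolePart k (dipole k c) = c := rfl

lemma Dip.massPart_dipole (c : Chain (k + 1)) : Dip.massPart k (dipole k c) = 0 := rfl

lemma Dip.dipolePart_massChain (c : Chain k) : Dip.dipolePart k (massChain k c) = 0 := rfl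

lemma Dip.massPart_massChain (c : Chain k) : Dip.massPart k (massChain k c) = c := rfl

lemma Dip.dipolePart_boundary (D : Dip (k + 1)) : Dip.dipolePart k (Dip.boundary k D) =
    Chain.boundary (k + 1) (Dip.dipolePart (k + 1) D) + Dip.massPart (k + 1) D := by
  rw [Dip.boundary_apply]
  exact add_zero _

lemma Dip.massPart_boundary (D : Dip (k + 1)) : Dip.massPart k (Dip.boundary k D) =
    Chain.boundary k (Dip.massPart (k + 1) D) := by
  rw [Dip.boundary_apply]
  exact zero_add _

lemma Dip.dipolePart_cone (p : E3) (D : Dip k) : Dip.dipolePart (k + 1) (Dip.cone p k D) =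
    Chain.cone p (k + 1) (Dip.dipolePart k D) :=
  add_zero _

lemma Dip.massPart_cone (p : E3) (D : Dip k) : Dip.massPart (k + 1) (Dip.cone p k D) =
    Chain.cone p k (Dip.massPart k D) :=
  zero_add _

end Parts

lemma Dip.sub_eq_add {k : ℕ} (D D' : Dip k) : D - D' = D + D' := by
  rw [sub_eq_add_neg, Dip.neg_eq]

lemma Dip.add_self {k : ℕ} (D : Dip k) : D + D = 0 := by
  rw [← Dip.sub_eq_add, sub_self]

lemma Dip.parity_add {k : ℕ} (D D' : Dip k) : (D + D').parity = D.parity + D'.parity := by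
  simp only [Dip.parity, map_add, Chain.parity_add]
  abel

lemma Chain.carrier_add_subset {j : ℕ} (c d : Chain j) :
    (c + d).carrier ⊆ c.carrier ∪ d.carrier := by
  classical
  refine Set.iUnion₂_subset fun σ hσ => ?_
  rcases Finset.mem_union.1 (Finsupp.support_add hσ) with h | h
  · exact (Set.subset_biUnion_of_mem (u := fun σ : Cell j => σ.carrier) h).trans Set.subset_union_left
  · exact (Set.subset_biUnion_of_mem (u := fun σ : Cell j => σ.carrier) h).trans Set.subset_union_right

lemma Chain.carrier_zero {j : ℕ} : (0 : Chain j).carrier = ∅ := by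
  simp [Chain.carrier]

lemma Chain.carrier_boundary_subset {j : ℕ} (c : Chain (j + 1)) :
    (Chain.boundary j c).carrier ⊆ c.carrier := by
  refine Set.iUnion₂_subset fun τ hτ => ?_
  obtain ⟨σ, hσ, h⟩ := Chain.mem_support_linearCombination hτ
  obtain ⟨hj, i, rfl⟩ := Cell.mem_support_boundary h
  refine (convexHull_mono ?_).trans (Set.subset_biUnion_of_mem (u := fun σ : Cell (j + 1) => σ.carrier) hσ)
  rintro _ ⟨l, rfl⟩
  exact ⟨_, rfl⟩

lemma Dip.carrier_add_subset {k : ℕ} (D D' : Dip k) :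
    (D + D').carrier ⊆ D.carrier ∪ D'.carrier := by
  have h1 := Chain.carrier_add_subset (Dip.dipolePart k D) (Dip.dipolePart k D')
  have h2 := Chain.carrier_add_subset (Dip.massPart k D) (Dip.massPart k D')
  rintro x (hx | hx)
  · exact (h1 hx).imp Or.inl Or.inl
  · exact (h2 hx).imp Or.inr Or.inr

lemma Dip.carrier_boundary_subset {k : ℕ} (D : Dip (k + 1)) :
    (Dip.boundary k D).carrier ⊆ D.carrier := by
  rintro x (hx | hx)
  · rw [Dip.dipolePart_boundary] at hx
    rcases Chain.carrier_add_subset _ _ hx with h | h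
    · exact Or.inl (Chain.carrier_boundary_subset _ h)
    · exact Or.inr h
  · rw [Dip.massPart_boundary] at hx
    exact Or.inr (Chain.carrier_boundary_subset _ hx)

/-- The homotopy formula for cones over dipolyhedra of positive dimension. -/
lemma Dip.boundary_cone (p : E3) {k : ℕ} (D : Dip (k + 1)) :
    Dip.boundary (k + 1) (Dip.cone p (k + 1) D) = D + Dip.cone p k (Dip.boundary k D) +
      massChain (k + 1) (Finsupp.single (pointCell p k) D.parity) := by
  apply Dip.ext
  · simp only [map_add, Dip.dipolePart_boundary, Dip.dipolePart_cone, Dip.massPart_cone,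
      Chain.boundary_cone, Dip.dipolePart_massChain]
    rw [Chain.parity_of_ne (by omega), Finsupp.single_zero]
    abel
  · simp only [map_add, Dip.massPart_boundary, Dip.massPart_cone, Chain.boundary_cone,
      Dip.massPart_massChain]
    rw [Dip.parity, Chain.parity_of_ne (by omega) (Dip.dipolePart (k + 1) D), zero_add]

/-- The homotopy formula for cones over dipolyhedra of dimension zero. -/
lemma Dip.boundary_cone_zero (p : E3) (D : Dip 0) :
    Dip.boundary 0 (Dip.cone p 0 D) =
      D + dipole 0 (Finsupp.single (pointCell p 0) D.parity) := by
  have h0 : Dip.massPart 0 D = 0 := Subsingleton.elim (α := Chain 0) _ _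
  apply Dip.ext
  · rw [Dip.dipolePart_boundary, Dip.dipolePart_cone, Dip.massPart_cone, Chain.boundary_cone,
      map_add, Dip.dipolePart_dipole, Dip.parity, h0, map_zero, Chain.parity_zero,
      Subsingleton.elim (α := Chain 0) (Chain.boundary 0 (Dip.dipolePart 0 D)) 0, map_zero,
      add_zero, add_zero, add_zero]
  · exact Subsingleton.elim (α := Chain 0) _ _

lemma dist_le_of_mem_cube {p x : E3} {r : ℝ} (hr : 0 ≤ r) (hx : x ∈ cube p r) :
    dist x p ≤ r * √3 / 2 := by
  rw [EuclideanSpace.dist_eq, Fin.sum_univ_three]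
  refine Real.sqrt_le_iff.2 ⟨by positivity, ?_⟩
  have h : ∀ i, dist (x i) (p i) ^ 2 ≤ (r / 2) ^ 2 := fun i => by
    have := hx i
    rw [Real.dist_eq]
    gcongr
  have h3 : √3 ^ 2 = 3 := Real.sq_sqrt (by norm_num)
  nlinarith [h 0, h 1, h 2]

/-- The mass part has one dimension less, which costs the factor two gained from the half diagonal
`r√3/2`: for `k ≥ 1`, `1/(2k) ≤ 1/(k+1)`. For `k = 0` there is no mass part. -/
lemma Dip.energy_cone_le {p : E3} {r : ℝ} (hr : 0 ≤ r) {k : ℕ} {D : Dip k}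
    (hD : D.carrier ⊆ cube p r) :
    (Dip.cone p k D).energy ≤ r * √3 / (k + 1) * D.energy := by
  have hR : 0 ≤ r * √3 / 2 := by positivity
  have h1 := Chain.mass_cone_le p hR (Dip.dipolePart k D)
    fun x hx => dist_le_of_mem_cube hr (hD (Or.inl hx))
  have h2 : (Chain.cone p k (Dip.massPart k D)).mass ≤
      r * √3 / (k + 1) * (Dip.massPart k D).mass := by
    cases k with
    | zero =>
      rw [Subsingleton.elim (α := Chain 0) (Dip.massPart 0 D) 0, map_zero, Chain.mass_zero,
        Chain.mass_zero, mul_zero]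
    | succ k =>
      refine (Chain.mass_cone_le p hR (Dip.massPart (k + 1) D)
        fun x hx => dist_le_of_mem_cube hr (hD (Or.inr hx))).trans ?_
      refine mul_le_mul_of_nonneg_right ?_ (Chain.mass_nonneg _)
      rw [div_div, div_le_div_iff₀ (by positivity) (by positivity)]
      push_cast
      refine mul_le_mul_of_nonneg_left ?_ (by positivity)
      have : (0 : ℝ) ≤ k := Nat.cast_nonneg k
      linarith
  rw [Dip.energy, Dip.weight, Dip.mass, Dip.dipolePart_cone, Dip.massPart_cone, Dip.energy,
    Dip.weight, Dip.mass, mul_add]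
  refine add_le_add (h1.trans ?_) h2
  refine mul_le_mul_of_nonneg_right ?_ (Chain.mass_nonneg _)
  rw [div_div, div_le_div_iff₀ (by positivity) (by positivity)]
  refine mul_le_mul_of_nonneg_left ?_ (by positivity)
  have : (0 : ℝ) ≤ k := Nat.cast_nonneg k
  linarith

/-! ## The retraction of dipolyhedra -/

namespace Retraction

variable {K : Set E3} (F : Retraction K) {k : ℕ}

/-- The action of a retraction on dipolyhedra. -/
def dip (k : ℕ) : Dip k →+ Dip k :=
  (dipole k).comp ((F.map (k + 1)).toAddMonoidHom.comp (Dip.dipolePart k)) +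
    (massChain k).comp ((F.map k).toAddMonoidHom.comp (Dip.massPart k))

lemma dipolePart_dip (D : Dip k) :
    Dip.dipolePart k (F.dip k D) = F.map (k + 1) (Dip.dipolePart k D) :=
  add_zero _

lemma massPart_dip (D : Dip k) : Dip.massPart k (F.dip k D) = F.map k (Dip.massPart k D) :=
  zero_add _

lemma boundary_dip (D : Dip (k + 1)) :
    Dip.boundary k (F.dip (k + 1) D) = F.dip k (Dip.boundary k D) := by
  apply Dip.ext
  · rw [Dip.dipolePart_boundary, dipolePart_dip, dipolePart_dip, massPart_dip,
      Dip.dipolePart_boundary, map_add, F.boundary_map]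
  · rw [Dip.massPart_boundary, massPart_dip, massPart_dip, Dip.massPart_boundary, F.boundary_map]

lemma energy_dip_le (D : Dip k) : (F.dip k D).energy ≤ D.energy := by
  rw [Dip.energy, Dip.weight, Dip.mass, dipolePart_dip, massPart_dip]
  exact add_le_add (F.mass_map_le _ _) (F.mass_map_le _ _)

lemma carrier_dip_subset (D : Dip k) : (F.dip k D).carrier ⊆ K := by
  rw [Dip.carrier, dipolePart_dip, massPart_dip]
  exact Set.union_subset (F.carrier_map_subset _ _) (F.carrier_map_subset _ _)

lemma dip_eq_self {D : Dip k} (h : D.carrier ⊆ K) : F.dip k D = D := by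
  apply Dip.ext
  · rw [dipolePart_dip, F.map_eq_self _ _ (Set.subset_union_left.trans h)]
  · rw [massPart_dip, F.map_eq_self _ _ (Set.subset_union_right.trans h)]

/-- The retraction commutes with `∂`, so it carries a decomposition of `D` to one of its image, with
no more energy. -/
lemma flatNorm_dip_le (D : Dip k) : (F.dip k D).flatNorm ≤ D.flatNorm := by
  refine le_of_forall_pos_le_add fun ε hε => ?_
  obtain ⟨Q, R, h, hl⟩ := D.exists_decomposition hε
  have h1 : (F.dip k D).flatNorm ≤ (F.dip k Q).energy + (F.dip (k + 1) R).energy := by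
    refine Dip.flatNorm_le ?_
    rw [F.boundary_dip, ← map_add, ← h]
  linarith [F.energy_dip_le Q, F.energy_dip_le R]

end Retraction

/-- A dipolyhedron in a cube has nearly optimal decompositions in the cube to which the homotopy
formula applies. -/
lemma Dip.exists_decomposition_cube {p : E3} {r : ℝ} (hr : 0 < r) {k : ℕ} {D : Dip k}
    (hD : D.carrier ⊆ cube p r) {ε : ℝ} (hε : 0 < ε) :
    ∃ (Q : Dip k) (R : Dip (k + 1)), D = Q + Dip.boundary k R ∧
      Q.energy + R.energy < D.flatNorm + ε ∧ Q.carrier ⊆ cube p r ∧ R.carrier ⊆ cube p r ∧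
      R.parity = 0 := by
  obtain ⟨F⟩ := exists_retraction_cube p hr
  obtain ⟨Q, R, h, hl⟩ := D.exists_decomposition hε
  have h1 : D = F.dip k Q + Dip.boundary k (F.dip (k + 1) R) := by
    rw [F.boundary_dip, ← map_add, ← h, F.dip_eq_self hD]
  have h2 : (F.dip k Q).energy + (F.dip (k + 1) R).energy < D.flatNorm + ε := by
    linarith [F.energy_dip_le Q, F.energy_dip_le R]
  have hQ := F.carrier_dip_subset Q
  have hR := F.carrier_dip_subset R
  revert h1 h2 hQ hR
  generalize F.dip k Q = Q
  generalize F.dip (k + 1) R = R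
  intro h1 h2 hQ hR
  cases k with
  | succ k =>
    refine ⟨Q, R, h1, h2, hQ, hR, ?_⟩
    rw [Dip.parity, Chain.parity_of_ne (by omega), Chain.parity_of_ne (by omega), add_zero]
  | zero =>
    set B := Dip.dipolePart 1 R with hB
    set C := Dip.massPart 1 R with hC
    -- For `0`-chains `∂(μC) = δC`, so the mass part of `R` can be moved into `Q` at no extra cost.
    -- Without it `R` has parity zero.
    refine ⟨Q + dipole 0 C, dipole 1 B, ?_, ?_, ?_, ?_, ?_⟩
    · rw [h1, add_assoc]
      congr 1
      apply Dip.ext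
      · rw [Dip.dipolePart_boundary, map_add, Dip.dipolePart_boundary, Dip.dipolePart_dipole,
          Dip.dipolePart_dipole, Dip.massPart_dipole]
        exact (add_comm _ _).trans (congrArg (C + ·) (add_zero _).symm)
      · exact Subsingleton.elim (α := Chain 0) _ _
    · have h3 := Chain.mass_add_le (Dip.dipolePart 0 Q) C
      simp only [Dip.energy, Dip.weight, Dip.mass, map_add, Dip.dipolePart_dipole,
        Dip.massPart_dipole, add_zero, Chain.mass_zero, ← hB, ← hC] at h2 ⊢
      linarith
    · refine (Dip.carrier_add_subset _ _).trans (Set.union_subset hQ ?_)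
      rw [Dip.carrier, Dip.dipolePart_dipole, Dip.massPart_dipole, Chain.carrier_zero,
        Set.union_empty]
      exact Set.subset_union_right.trans hR
    · rw [Dip.carrier, Dip.dipolePart_dipole, Dip.massPart_dipole, Chain.carrier_zero,
        Set.union_empty]
      exact Set.subset_union_left.trans hR
    · rw [Dip.parity, Dip.massPart_dipole, Chain.parity_zero, Chain.parity_of_ne (by omega),
        add_zero]

lemma Dip.flatNorm_cone_le {p : E3} {r : ℝ} (hr : 0 < r) {k : ℕ} {D : Dip k}
    (hD : D.carrier ⊆ cube p r) :
    (Dip.cone p k D).flatNorm ≤ (1 + r * √3 / (k + 1)) * D.flatNorm := by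
  have hc : 0 ≤ r * √3 / (k + 1) := by positivity
  have key : ∀ ε, 0 < ε →
      (Dip.cone p k D).flatNorm ≤ (1 + r * √3 / (k + 1)) * (D.flatNorm + ε) := by
    intro ε hε
    obtain ⟨Q, R, h, hl, hQ, hR, hpar⟩ := Dip.exists_decomposition_cube hr hD hε
    -- The homotopy formula for `R` replaces `p(∂R)` by `R + ∂(pR)`.
    have h1 : Dip.cone p k D = (Dip.cone p k Q + R) + Dip.boundary (k + 1) (Dip.cone p (k + 1) R) := by
      rw [Dip.boundary_cone, hpar, Finsupp.single_zero, map_zero, add_zero, ← add_assoc,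
        add_assoc _ R R, Dip.add_self, add_zero, ← map_add, ← h]
    have h2 := Dip.flatNorm_le h1
    have h3 := Dip.energy_add_le (Dip.cone p k Q) R
    have h4 := Dip.energy_cone_le hr.le hQ
    have h5 := Dip.energy_cone_le hr.le hR
    -- The cone over `R` has the smaller constant of dimension `k + 1`, so `R`, which is counted
    -- once more by itself, costs at most `1 + r√3/(k+1)` times its energy.
    have h6 : r * √3 / ((k + 1 : ℕ) + 1) ≤ r * √3 / (k + 1) := by
      push_cast
      gcongr
      linarith
    have h7 := mul_le_mul_of_nonneg_right h6 R.energy_nonneg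
    have h8 := mul_le_mul_of_nonneg_left hl.le (by linarith : 0 ≤ 1 + r * √3 / (k + 1))
    linarith [Q.energy_nonneg]
  have hlim : Tendsto (fun ε : ℝ => (1 + r * √3 / (k + 1)) * (D.flatNorm + ε)) (𝓝[>] 0)
      (𝓝 ((1 + r * √3 / (k + 1)) * (D.flatNorm + 0))) :=
    ((continuous_const.mul (continuous_const.add continuous_id)).tendsto 0).mono_left
      nhdsWithin_le_nhds
  rw [add_zero] at hlim
  exact ge_of_tendsto hlim (eventually_mem_nhdsWithin.mono fun ε hε => key ε hε)

/-! ## Parity -/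

/-- Mass of a `0`-chain is a counting measure and distinct `0`-cells are distinct points, so a
nonzero `0`-chain has mass at least one. -/
lemma Chain.parity_eq_zero_of_mass_lt_one {j : ℕ} {c : Chain j} (h : c.mass < 1) :
    c.parity = 0 := by
  by_cases hj : j = 1
  · subst hj
    suffices hc : c = 0 by rw [hc, Chain.parity_zero]
    by_contra hc
    obtain ⟨σ, hσ⟩ := Finsupp.support_nonempty_iff.2 hc
    have hcar : ∀ τ : Cell 1, τ.carrier = {τ.1 0} := fun τ => by
      rw [Cell.carrier, Set.range_unique, convexHull_singleton]
      rfl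
    have hm : c.multiplicity (σ.1 0) ≠ 0 := by
      rw [Chain.multiplicity, Finsupp.sum, Finset.sum_eq_single σ]
      · rw [hcar, Set.indicator_of_mem (Set.mem_singleton _)]
        exact Finsupp.mem_support_iff.1 hσ
      · intro τ _ hτ
        rw [hcar]
        refine Set.indicator_of_notMem (fun h => hτ (Subtype.ext (funext fun i => ?_))) _
        rw [Subsingleton.elim i 0]
        exact (Set.mem_singleton_iff.1 h).symm
      · exact fun h => absurd hσ h
    have h1 : (1 : ℝ≥0∞) ≤ (Measure.euclideanHausdorffMeasure (1 - 1) : Measure E3)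
        {x : E3 | c.multiplicity x ≠ 0} := by
      calc (1 : ℝ≥0∞) = (Measure.euclideanHausdorffMeasure 0 : Measure E3) {σ.1 0} := by
            rw [Measure.euclideanHausdorffMeasure_zero, Measure.hausdorffMeasure_zero_singleton]
        _ ≤ _ := measure_mono (Set.singleton_subset_iff.2 hm)
    have h2 := ENNReal.toReal_mono c.measure_oddSet_ne_top h1
    rw [ENNReal.toReal_one] at h2
    exact absurd h (not_lt.2 h2)
  · exact Chain.parity_of_ne hj c

/-- Take a decomposition of total energy less than one. Its `0`-dimensional parts are then even, and
the boundary terms are always even. -/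
lemma Dip.parity_eq_zero_of_flatNorm_lt_one {k : ℕ} {D : Dip k} (h : D.flatNorm < 1) :
    D.parity = 0 := by
  obtain ⟨Q, R, rfl, hl⟩ := D.exists_decomposition (sub_pos.2 h)
  rw [add_sub_cancel] at hl
  simp only [Dip.energy, Dip.weight, Dip.mass] at hl
  have h1 := Chain.mass_nonneg (Dip.dipolePart k Q)
  have h2 := Chain.mass_nonneg (Dip.massPart k Q)
  have h3 := Chain.mass_nonneg (Dip.dipolePart (k + 1) R)
  have h4 := Chain.mass_nonneg (Dip.massPart (k + 1) R)
  rw [Dip.parity, map_add, map_add, Dip.dipolePart_boundary, Dip.massPart_boundary]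
  simp only [Chain.parity_add, Chain.parity_boundary]
  rw [Chain.parity_eq_zero_of_mass_lt_one (c := Dip.dipolePart k Q) (by linarith),
    Chain.parity_eq_zero_of_mass_lt_one (c := Dip.massPart k Q) (by linarith),
    Chain.parity_eq_zero_of_mass_lt_one (c := Dip.massPart (k + 1) R) (by linarith)]
  simp

/-! ## Cones over flat dipolyhedra -/

section Flat

variable {k : ℕ} {A : FlatDip k} {D D' : ℕ → Dip k} {p : E3}

lemma exists_cube_superset (p : E3) {S : Set E3} (hS : Bornology.IsBounded S) :
    ∃ r, 0 < r ∧ S ⊆ cube p r := by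
  obtain ⟨R, hR⟩ := hS.subset_closedBall p
  refine ⟨2 * max R 1, by positivity, fun x hx i => ?_⟩
  have h1 : dist x p ≤ R := hR hx
  have h2 := PiLp.norm_apply_le (x - p) i
  rw [← dist_eq_norm] at h2
  rw [mul_div_cancel_left₀ _ (two_ne_zero)]
  exact (h2.trans h1).trans (le_max_left _ _)

lemma CompactlySupported.exists_boundedlyTendsTo (h : CompactlySupported A) :
    ∃ D, BoundedlyTendsTo D A := by
  obtain ⟨K, hK, hS⟩ := h
  obtain ⟨R, hR⟩ := hK.isBounded.subset_ball (0 : E3)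
  obtain ⟨D, hD, hU⟩ := hS.2 _ Metric.isOpen_ball hR
  exact ⟨D, hD, Metric.isBounded_ball.subset (Set.iUnion_subset hU)⟩

lemma tendsToFlat_iff_of_tendsToFlat (h : TendsToFlat D A) :
    TendsToFlat D' A ↔ Tendsto (fun i => ‖D i - D' i‖) atTop (𝓝 0) := by
  have e : ∀ i, ‖D i - D' i‖ = dist (D i : FlatDip k) (D' i) := fun i => by
    rw [UniformSpace.Completion.dist_eq, dist_eq_norm]
  simp only [e]
  constructor
  · intro h'
    have := h.dist h'
    rwa [dist_self] at this
  · exact fun h0 => (tendsto_iff_of_dist h0).1 h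

lemma norm_cone_sub_le {r : ℝ} (hr : 0 < r) {D D' : Dip k} (h : D.carrier ⊆ cube p r)
    (h' : D'.carrier ⊆ cube p r) :
    ‖Dip.cone p k D - Dip.cone p k D'‖ ≤ (1 + r * √3 / (k + 1)) * ‖D - D'‖ := by
  rw [← map_sub, Dip.norm_eq, Dip.norm_eq]
  refine Dip.flatNorm_cone_le hr ?_
  rw [Dip.sub_eq_add]
  exact (Dip.carrier_add_subset D D').trans (Set.union_subset h h')

/-- On dipolyhedra in one cube the cone operator is Lipschitz, so it preserves Cauchy sequences; two
sequences with bounded supports fit into a common cube, so their cones have the same limit. -/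
lemma CompactlySupported.exists_isCone (p : E3) (h : CompactlySupported A) :
    ∃ X, IsCone p A X := by
  obtain ⟨D, hD⟩ := h.exists_boundedlyTendsTo
  have hX : ∃ X, TendsToFlat (fun i => Dip.cone p k (D i)) X := by
    refine cauchySeq_tendsto_of_complete ?_
    obtain ⟨r, hr, hDr⟩ := exists_cube_superset p hD.2
    have hc : 0 < 1 + r * √3 / ((k : ℝ) + 1) := by positivity
    refine Metric.cauchySeq_iff.2 fun ε hε => ?_
    obtain ⟨N, hN⟩ := Metric.cauchySeq_iff.1 hD.1.cauchySeq (ε / (1 + r * √3 / (k + 1)))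
      (div_pos hε hc)
    refine ⟨N, fun m hm n hn => ?_⟩
    have h1 := hN m hm n hn
    rw [UniformSpace.Completion.dist_eq, dist_eq_norm, lt_div_iff₀' hc] at h1
    rw [UniformSpace.Completion.dist_eq, dist_eq_norm]
    exact (norm_cone_sub_le hr ((Set.subset_iUnion _ m).trans hDr)
      ((Set.subset_iUnion _ n).trans hDr)).trans_lt h1
  obtain ⟨X, hX⟩ := hX
  refine ⟨X, ⟨D, hD⟩, fun D' hD' => ?_⟩
  obtain ⟨r, hr, hDr⟩ := exists_cube_superset p (hD.2.union hD'.2)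
  rw [Set.union_subset_iff, Set.iUnion_subset_iff, Set.iUnion_subset_iff] at hDr
  rw [tendsToFlat_iff_of_tendsToFlat hX]
  have h1 := ((tendsToFlat_iff_of_tendsToFlat hD.1).1 hD'.1).const_mul (1 + r * √3 / (k + 1))
  rw [mul_zero] at h1
  exact squeeze_zero (fun _ => norm_nonneg _)
    (fun i => norm_cone_sub_le hr (hDr.1 i) (hDr.2 i)) h1

lemma CompactlySupported.isCone_cone (p : E3) (h : CompactlySupported A) :
    IsCone p A (FlatDip.cone p A) := by
  have := h.exists_isCone p
  rw [FlatDip.cone, dif_pos this]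
  exact this.choose_spec

lemma IsCone.unique {X Y : FlatDip (k + 1)} (hX : IsCone p A X) (hY : IsCone p A Y) : X = Y := by
  obtain ⟨D, hD⟩ := hX.1
  exact tendsto_nhds_unique (hX.2 D hD) (hY.2 D hD)

lemma TendsToFlat.boundary {A : FlatDip (k + 1)} {D : ℕ → Dip (k + 1)} (h : TendsToFlat D A) :
    TendsToFlat (fun i => Dip.boundary k (D i)) (FlatDip.boundary k A) := by
  have h1 := ((AddMonoidHom.continuous_completion (Dip.boundary k)
    (Dip.continuous_boundary k)).tendsto A).comp h
  refine h1.congr fun i => ?_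
  exact AddMonoidHom.completion_coe (Dip.boundary k) (Dip.continuous_boundary k) (D i)

lemma BoundedlyTendsTo.boundary {A : FlatDip (k + 1)} {D : ℕ → Dip (k + 1)}
    (h : BoundedlyTendsTo D A) :
    BoundedlyTendsTo (fun i => Dip.boundary k (D i)) (FlatDip.boundary k A) :=
  ⟨h.1.boundary, h.2.subset (Set.iUnion_mono fun i => (D i).carrier_boundary_subset)⟩

lemma CompactlySupported.boundary {A : FlatDip (k + 1)} (h : CompactlySupported A) :
    CompactlySupported (FlatDip.boundary k A) := by
  obtain ⟨K, hK, hc, hS⟩ := h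
  refine ⟨K, hK, hc, fun U hU hKU => ?_⟩
  obtain ⟨D, hD, hDU⟩ := hS U hU hKU
  exact ⟨_, hD.boundary, fun i => (D i).carrier_boundary_subset.trans (hDU i)⟩

/-- Two sequences with the same limit are eventually at flat distance less than one, hence have
equal parities. Thus evenness passes from the given sequence, whose supports may be unbounded, to
any other. -/
lemma EvenZeroPart.eventually_parity_eq_zero (h : EvenZeroPart A) (hD : TendsToFlat D A) :
    ∀ᶠ i in atTop, (D i).parity = 0 := by
  obtain ⟨D', hD', hpar⟩ := h
  have h1 := (tendsToFlat_iff_of_tendsToFlat hD).1 hD'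
  filter_upwards [h1.eventually_lt_const one_pos] with i hi
  have h2 := Dip.parity_eq_zero_of_flatNorm_lt_one (D := D i - D' i) hi
  rwa [Dip.sub_eq_add, Dip.parity_add, hpar i, add_zero] at h2

lemma CompactlySupported.eq_boundary_cone_add {A : FlatDip (k + 1)} (h : CompactlySupported A)
    (hA : 2 ≤ k + 1 ∨ EvenZeroPart A) :
    A = FlatDip.boundary (k + 1) (FlatDip.cone p A) + FlatDip.cone p (FlatDip.boundary k A) := by
  obtain ⟨D, hD⟩ := h.exists_boundedlyTendsTo
  have hpar : ∀ᶠ i in atTop, (D i).parity = 0 := by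
    rcases hA with hA | hA
    · refine Eventually.of_forall fun i => ?_
      rw [Dip.parity, Chain.parity_of_ne (by omega), Chain.parity_of_ne (by omega), add_zero]
    · exact hA.eventually_parity_eq_zero hD.1
  have h1 := ((h.isCone_cone p).2 D hD).boundary
  have h2 := (h.boundary.isCone_cone p).2 _ hD.boundary
  refine tendsto_nhds_unique (hD.1.congr' ?_) (h1.add h2)
  filter_upwards [hpar] with i hi
  rw [← UniformSpace.Completion.coe_add, Dip.boundary_cone, hi, Finsupp.single_zero, map_zero,
    add_zero, add_assoc, Dip.add_self, add_zero]

lemma CompactlySupported.eq_boundary_cone {A : FlatDip 0} (h : CompactlySupported A)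
    (hA : EvenZeroPart A) : A = FlatDip.boundary 0 (FlatDip.cone p A) := by
  obtain ⟨D, hD⟩ := h.exists_boundedlyTendsTo
  have h1 := ((h.isCone_cone p).2 D hD).boundary
  refine tendsto_nhds_unique (hD.1.congr' ?_) h1
  filter_upwards [hA.eventually_parity_eq_zero hD.1] with i hi
  rw [Dip.boundary_cone_zero, hi, Finsupp.single_zero, map_zero, add_zero]

lemma isCompact_cube (p : E3) (r : ℝ) : IsCompact (cube p r) := by
  refine Metric.isCompact_of_isClosed_isBounded ?_ ?_
  · have : cube p r = ⋂ i, {x : E3 | |x i - p i| ≤ r / 2} := by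
      ext x
      simp [cube]
    rw [this]
    exact isClosed_iInter fun i => isClosed_le (by fun_prop) continuous_const
  · rcases le_or_gt 0 r with hr | hr
    · exact Metric.isBounded_closedBall.subset fun x hx => dist_le_of_mem_cube hr hx
    · refine Bornology.isBounded_empty.subset fun x hx => ?_
      have := (abs_nonneg _).trans (hx 0)
      linarith

lemma isBounded_of_subset_cube {S : ℕ → Set E3} {r : ℝ} (h : ∀ i, S i ⊆ cube p r) :
    Bornology.IsBounded (⋃ i, S i) :=
  (isCompact_cube p r).isBounded.subset (Set.iUnion_subset h)

/-- Approximants are only available in open neighbourhoods of the cube, hence in a larger one; the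
estimates for `r` follow by letting `s` decrease to `r`. -/
lemma Supports.exists_tendsToFlat_cube {r s : ℝ} (hrs : r < s) (h : Supports (cube p r) A) :
    ∃ D, TendsToFlat D A ∧ ∀ i, (D i).carrier ⊆ cube p s := by
  have hU : IsOpen (⋂ i, {x : E3 | |x i - p i| < s / 2}) :=
    isOpen_iInter_of_finite fun i => isOpen_lt (by fun_prop) continuous_const
  obtain ⟨D, hD, hDU⟩ := h.2 _ hU fun x hx => Set.mem_iInter.2 fun i =>
    (hx i).trans_lt (by linarith)
  exact ⟨D, hD, fun i x hx l => (Set.mem_iInter.1 (hDU i hx) l).le⟩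

lemma Supports.compactlySupported {r : ℝ} (h : Supports (cube p r) A) : CompactlySupported A :=
  ⟨_, isCompact_cube p r, h⟩

lemma Supports.norm_cone_le {r : ℝ} (hr : 0 < r) (h : Supports (cube p r) A) :
    ‖FlatDip.cone p A‖ ≤ (1 + r * √3 / (k + 1)) * ‖A‖ := by
  have key : ∀ s, r < s → ‖FlatDip.cone p A‖ ≤ (1 + s * √3 / (k + 1)) * ‖A‖ := by
    intro s hs
    obtain ⟨D, hD, hDs⟩ := h.exists_tendsToFlat_cube hs
    have h1 := (h.compactlySupported.isCone_cone p).2 D ⟨hD, isBounded_of_subset_cube hDs⟩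
    refine le_of_tendsto_of_tendsto' h1.norm (hD.norm.const_mul (1 + s * √3 / (k + 1))) fun i => ?_
    rw [UniformSpace.Completion.norm_coe, UniformSpace.Completion.norm_coe]
    exact Dip.flatNorm_cone_le (hr.trans hs) (hDs i)
  have hcont : Continuous fun s : ℝ => (1 + s * √3 / (k + 1)) * ‖A‖ := by fun_prop
  exact ge_of_tendsto ((hcont.tendsto r).mono_left (nhdsWithin_le_nhds (s := Set.Ioi r)))
    (eventually_mem_nhdsWithin.mono fun s hs => key s hs)

lemma Supports.energy_cone_le {r : ℝ} (hr : 0 < r) (h : Supports (cube p r) A) :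
    (FlatDip.cone p A).energy ≤ ENNReal.ofReal (r * √3 / (k + 1)) * A.energy := by
  have key : ∀ s, r < s →
      (FlatDip.cone p A).energy ≤ ENNReal.ofReal (s * √3 / (k + 1)) * A.energy := by
    intro s hs
    have hs0 : 0 < s := hr.trans hs
    have hc : 0 < s * √3 / ((k : ℝ) + 1) := by positivity
    obtain ⟨F⟩ := exists_retraction_cube p hs0
    obtain ⟨D, hD, hDs⟩ := h.exists_tendsToFlat_cube hs
    rw [FlatDip.energy, FlatDip.energy]
    simp only [ENNReal.mul_iInf_of_ne (ENNReal.ofReal_pos.2 hc).ne' ENNReal.ofReal_ne_top]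
    refine le_iInf₂ fun E hE => ?_
    -- The sequence `E` may leave the cube. Its retraction still tends to `A`, because `F` fixes the
    -- sequence `D`, which also tends to `A`, and does not increase flat distances.
    have hFE : TendsToFlat (fun i => F.dip k (E i)) A := by
      rw [tendsToFlat_iff_of_tendsToFlat hD]
      refine squeeze_zero (fun _ => norm_nonneg _) (fun i => ?_)
        ((tendsToFlat_iff_of_tendsToFlat hD).1 hE)
      nth_rewrite 1 [← F.dip_eq_self (hDs i)]
      rw [← map_sub]
      exact F.flatNorm_dip_le _
    have h1 := (h.compactlySupported.isCone_cone p).2 _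
      ⟨hFE, isBounded_of_subset_cube fun i => F.carrier_dip_subset (E i)⟩
    refine le_trans (iInf₂_le (fun i => Dip.cone p k (F.dip k (E i))) h1) ?_
    rw [← ENNReal.liminf_const_mul_of_ne_top ENNReal.ofReal_ne_top]
    refine liminf_le_liminf (Eventually.of_forall fun i => ?_)
    rw [← ENNReal.ofReal_mul hc.le]
    refine ENNReal.ofReal_le_ofReal ?_
    exact (Dip.energy_cone_le hs0.le (F.carrier_dip_subset (E i))).trans
      (mul_le_mul_of_nonneg_left (F.energy_dip_le (E i)) hc.le)
  -- The energy of `A` may be infinite, and multiplication by `∞` is continuous only away from zero.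
  have hr0 : ENNReal.ofReal (r * √3 / (k + 1)) ≠ 0 := (ENNReal.ofReal_pos.2 (by positivity)).ne'
  have hcont : Continuous fun s : ℝ => ENNReal.ofReal (s * √3 / (k + 1)) :=
    ENNReal.continuous_ofReal.comp (by fun_prop)
  exact ge_of_tendsto (ENNReal.Tendsto.mul_const
      ((hcont.tendsto r).mono_left (nhdsWithin_le_nhds (s := Set.Ioi r))) (Or.inl hr0))
    (eventually_mem_nhdsWithin.mono fun s hs => key s hs)

end Flat

end

end Dipolyhedron

theorem mainTheorem7 (p : E3) :
    -- the estimate for dipolyhedra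
    (∀ (k : ℕ) (D : Dipolyhedron.Dip k) (r : ℝ), 0 < r →
      D.carrier ⊆ Dipolyhedron.cube p r →
        (Dipolyhedron.Dip.cone p k D).flatNorm ≤ (1 + r * √3 / (k + 1)) * D.flatNorm) ∧
    -- the cone over a compactly supported flat dipolyhedron is well defined
    (∀ (k : ℕ) (A : Dipolyhedron.FlatDip k), Dipolyhedron.CompactlySupported A →
      Dipolyhedron.IsCone p A (Dipolyhedron.FlatDip.cone p A) ∧
        ∀ X, Dipolyhedron.IsCone p A X → X = Dipolyhedron.FlatDip.cone p A) ∧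
    -- `A = ∂(pA) + p(∂A)` in dimension `k + 1 ≥ 1`
    (∀ (k : ℕ) (A : Dipolyhedron.FlatDip (k + 1)), Dipolyhedron.CompactlySupported A →
      Dipolyhedron.CompactlySupported (Dipolyhedron.FlatDip.boundary k A) ∧
        (2 ≤ k + 1 ∨ Dipolyhedron.EvenZeroPart A →
          A = Dipolyhedron.FlatDip.boundary (k + 1) (Dipolyhedron.FlatDip.cone p A) +
            Dipolyhedron.FlatDip.cone p (Dipolyhedron.FlatDip.boundary k A))) ∧
    -- `A = ∂(pA) + p(∂A)` in dimension `0`, where `∂A = 0`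
    (∀ A : Dipolyhedron.FlatDip 0, Dipolyhedron.CompactlySupported A →
      Dipolyhedron.EvenZeroPart A →
        A = Dipolyhedron.FlatDip.boundary 0 (Dipolyhedron.FlatDip.cone p A)) ∧
    -- the estimates for flat dipolyhedra
    (∀ (k : ℕ) (A : Dipolyhedron.FlatDip k) (r : ℝ), 0 < r →
      Dipolyhedron.Supports (Dipolyhedron.cube p r) A →
        ‖Dipolyhedron.FlatDip.cone p A‖ ≤ (1 + r * √3 / (k + 1)) * ‖A‖ ∧
        (Dipolyhedron.FlatDip.cone p A).energy ≤
          ENNReal.ofReal (r * √3 / (k + 1)) * A.energy) := by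
  refine ⟨fun k D r hr hD => Dipolyhedron.Dip.flatNorm_cone_le hr hD,
    fun k A hA => ⟨hA.isCone_cone p, fun X hX => hX.unique (hA.isCone_cone p)⟩,
    fun k A hA => ⟨hA.boundary, hA.eq_boundary_cone_add⟩,
    fun A hA hE => hA.eq_boundary_cone hE,
    fun k A r hr hA => ⟨hA.norm_cone_le hr, hA.energy_cone_le hr⟩⟩
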